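/- **Proposition 10.** A (time-oriented) conformal spacetime is a smooth manifold with a conformal class of Lorentzian metrics of signature $(1,n-1)$ ($g'\sim g$ iff $g'=e^{\varphi}g$ with $\varphi$ smooth) and a continuous choice of a component of the timelike cone at each point. $I^{\pm}(\cdot)$ and $J^{\pm}(\cdot)$ denote chronological and causal futures/pasts. The spacetime is globally hyperbolic (GH) if it is strongly causal and all intersections $J^-(p)\cap J^+(q)$ are compact. A Cauchy hypersurface is a topological hypersurface met exactly once by every inextensible causal curve. A past set is an open set $U$ with $I^-(U)\subset U$; an indecomposable past set (IP) is a non-empty past set that is not the union of two past sets both different from it; a terminal indecomposable past set (TIP) is an IP of the form $I^-(\gamma)$ with $\gamma$ a future-directed causal curve inextensible in the future. The future causal boundary of a GH conformal spacetime is the set of its TIPs. Let $M$ and $N$ be GH conformal spacetimes of dimension $n$ and let $f:M\to N$ be a conformal Cauchy-embedding, that is, a smooth embedding that pulls the conformal class of $N$ back to that of $M$, preserves the time-orientation, and maps every Cauchy hypersurface of $M$ onto a Cauchy hypersurface of $N$. Let $\partial^+f(M)$ be the future boundary of $f(M)$: the set of points of the topological boundary of $f(M)$ in $N$ that lie in $I^+(f(S))$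 for some Cauchy hypersurface $S$ of $M$. Then for every $p\in\partial^+f(M)$ the set $$f^{-1}\bigl(I^-(p)\cap f(M)\bigr)$$ is a TIP of $M$. Moreover, the resulting map $p\mapsto f^{-1}(I^-(p)\cap f(M))$ from $\partial^+f(M)$ to the future causal boundary of $M$ is injective. -/

import Mathlib

open Set Filter Topology Manifold
open scoped ContDiff

/-- A smooth Lorentzian metric on a smooth manifold `M` of dimension `n`: a smooth section of
symmetric bilinear forms of signature `(1, n - 1)` on the tangent spaces.  The signature condition
is expressed as: some vector is negative, and the form is positive definite on its orthogonal
complement (in particular the form is nondegenerate). -/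
structure LorentzianMetric (n : ℕ) (M : Type*) [TopologicalSpace M]
    [ChartedSpace (EuclideanSpace ℝ (Fin n)) M] [IsManifold (𝓡 n) ∞ M] where
  form (x : M) : TangentSpace (𝓡 n) x →L[ℝ] TangentSpace (𝓡 n) x →L[ℝ] ℝ
  symm (x : M) (v w : TangentSpace (𝓡 n) x) : form x v w = form x w v
  lorentzian (x : M) : ∃ v : TangentSpace (𝓡 n) x, form x v v < 0 ∧
    ∀ w : TangentSpace (𝓡 n) x, w ≠ 0 → form x v w = 0 → 0 < form x w w
  contMDiff : ContMDiff (𝓡 n)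
    ((𝓡 n).prod 𝓘(ℝ, EuclideanSpace ℝ (Fin n) →L[ℝ] EuclideanSpace ℝ (Fin n) →L[ℝ] ℝ)) ∞
    (fun x => Bundle.TotalSpace.mk'
      (EuclideanSpace ℝ (Fin n) →L[ℝ] EuclideanSpace ℝ (Fin n) →L[ℝ] ℝ) x (form x))

/-- Conformal equivalence of Lorentzian metrics: `g' = e ^ φ • g` with `φ` smooth. -/
def LorentzianMetric.ConformallyEquivalent {n : ℕ} {M : Type*} [TopologicalSpace M]
    [ChartedSpace (EuclideanSpace ℝ (Fin n)) M] [IsManifold (𝓡 n) ∞ M]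
    (g g' : LorentzianMetric n M) : Prop :=
  ∃ φ : M → ℝ, ContMDiff (𝓡 n) 𝓘(ℝ, ℝ) ∞ φ ∧
    ∀ (x : M) (v w : TangentSpace (𝓡 n) x), g'.form x v w = Real.exp (φ x) * g.form x v w

/-- Conformal equivalence is an equivalence relation. -/
def conformalSetoid (n : ℕ) (M : Type*) [TopologicalSpace M]
    [ChartedSpace (EuclideanSpace ℝ (Fin n)) M] [IsManifold (𝓡 n) ∞ M] :
    Setoid (LorentzianMetric n M) where
  r := LorentzianMetric.ConformallyEquivalent
  iseqv := by
    refine ⟨fun g => ⟨fun _ => 0, contMDiff_const, by simp⟩, ?_, ?_⟩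
    · rintro g g' ⟨φ, hφ, h⟩
      refine ⟨fun x => -φ x, hφ.neg, fun x v w => ?_⟩
      rw [h, ← mul_assoc, ← Real.exp_add]
      simp
    · rintro g g' g'' ⟨φ, hφ, h⟩ ⟨ψ, hψ, h'⟩
      refine ⟨fun x => ψ x + φ x, hψ.add hφ, fun x v w => ?_⟩
      rw [h', h, ← mul_assoc, ← Real.exp_add]

/-- A conformal class of Lorentzian metrics. -/
def ConformalClass (n : ℕ) (M : Type*) [TopologicalSpace M]
    [ChartedSpace (EuclideanSpace ℝ (Fin n)) M] [IsManifold (𝓡 n) ∞ M] : Type _ :=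
  Quotient (conformalSetoid n M)

/-- The Lorentzian metric `g` belongs to the conformal class `C`. -/
def ConformalClass.Contains {n : ℕ} {M : Type*} [TopologicalSpace M]
    [ChartedSpace (EuclideanSpace ℝ (Fin n)) M] [IsManifold (𝓡 n) ∞ M]
    (C : ConformalClass n M) (g : LorentzianMetric n M) : Prop :=
  Quotient.mk (conformalSetoid n M) g = C

/-- The timelike vectors at `x`: those that are negative for a metric of the conformal class
(equivalently, for all of them). -/
def ConformalClass.timelikeCone {n : ℕ} {M : Type*} [TopologicalSpace M]
    [ChartedSpace (EuclideanSpace ℝ (Fin n)) M] [IsManifold (𝓡 n) ∞ M]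
    (C : ConformalClass n M) (x : M) : Set (TangentSpace (𝓡 n) x) :=
  {v | ∃ g : LorentzianMetric n M, C.Contains g ∧ g.form x v v < 0}

/-- A time-oriented conformal structure of dimension `n` on the smooth manifold `M`: a conformal
class of Lorentzian metrics, with a continuous choice `future x` of a connected component of the
timelike vectors at every point (continuity: the chosen vectors form an open subset of the tangent
bundle). -/
structure ConformalSpacetime (n : ℕ) (M : Type*) [TopologicalSpace M]
    [ChartedSpace (EuclideanSpace ℝ (Fin n)) M] [IsManifold (𝓡 n) ∞ M] where
  conformalClass : ConformalClass n M
  future (x : M) : Set (TangentSpace (𝓡 n) x)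
  future_component (x : M) : ∃ v ∈ conformalClass.timelikeCone x,
    future x = connectedComponentIn (conformalClass.timelikeCone x) v
  future_isOpen : IsOpen {w : TangentBundle (𝓡 n) M | w.2 ∈ future w.1}

namespace ConformalSpacetime

variable {n : ℕ} {M : Type*} [TopologicalSpace M]
  [ChartedSpace (EuclideanSpace ℝ (Fin n)) M] [IsManifold (𝓡 n) ∞ M]

/-- Future-directed causal vectors: the nonzero vectors in the closure of the future-directed
timelike vectors, that is, the future-directed timelike or lightlike vectors. -/
def causalFuture (𝒮 : ConformalSpacetime n M) (x : M) : Set (TangentSpace (𝓡 n) x) :=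
  {v | v ≠ 0 ∧ v ∈ closure (𝒮.future x)}

/-- On the interval `[a, b]`, the curve `γ` is continuously differentiable (one-sided at the
endpoints) with velocity in the family of cones `K`. -/
def IsArc (K : ∀ x : M, Set (TangentSpace (𝓡 n) x)) (γ : ℝ → M) (a b : ℝ) : Prop :=
  ContMDiffOn 𝓘(ℝ, ℝ) (𝓡 n) 1 γ (Icc a b) ∧
    ∀ t ∈ Icc a b, mfderivWithin 𝓘(ℝ, ℝ) (𝓡 n) γ (Icc a b) t (1 : ℝ) ∈ K (γ t)

/-- The restriction of `γ` to the nonempty interval `J` is a piecewise continuously differentiable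
curve whose velocities (one-sided at the breaks) lie in the family of cones `K`: every point of `J`
other than the last (first) one is the start (end) of an arc.  Only the values of `γ` on `J`
matter. -/
def IsCurve (K : ∀ x : M, Set (TangentSpace (𝓡 n) x)) (γ : ℝ → M) (J : Set ℝ) : Prop :=
  J.Nonempty ∧ J.OrdConnected ∧
    ∀ t ∈ J, ((∃ s ∈ J, t < s) → ∃ s ∈ J, t < s ∧ IsArc K γ t s) ∧
      ((∃ s ∈ J, s < t) → ∃ s ∈ J, s < t ∧ IsArc K γ s t)

/-- Future-directed timelike curves. -/
def IsTimelikeCurve (𝒮 : ConformalSpacetime n M) (γ : ℝ → M) (J : Set ℝ) : Prop :=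
  IsCurve 𝒮.future γ J

/-- Future-directed causal curves. -/
def IsCausalCurve (𝒮 : ConformalSpacetime n M) (γ : ℝ → M) (J : Set ℝ) : Prop :=
  IsCurve 𝒮.causalFuture γ J

/-- The chronological future `I⁺(A)`. -/
def chronFuture (𝒮 : ConformalSpacetime n M) (A : Set M) : Set M :=
  {q | ∃ p ∈ A, ∃ (γ : ℝ → M) (a b : ℝ), a < b ∧ 𝒮.IsTimelikeCurve γ (Icc a b) ∧
    γ a = p ∧ γ b = q}

/-- The chronological past `I⁻(A)`. -/
def chronPast (𝒮 : ConformalSpacetime n M) (A : Set M) : Set M :=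
  {p | ∃ q ∈ A, ∃ (γ : ℝ → M) (a b : ℝ), a < b ∧ 𝒮.IsTimelikeCurve γ (Icc a b) ∧
    γ a = p ∧ γ b = q}

/-- The causal future `J⁺(p)`; by the usual convention it contains `p`. -/
def causalFutureOf (𝒮 : ConformalSpacetime n M) (p : M) : Set M :=
  {q | ∃ (γ : ℝ → M) (a b : ℝ), a ≤ b ∧ 𝒮.IsCausalCurve γ (Icc a b) ∧ γ a = p ∧ γ b = q}

/-- The causal past `J⁻(p)`; by the usual convention it contains `p`. -/
def causalPastOf (𝒮 : ConformalSpacetime n M) (p : M) : Set M :=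
  {q | p ∈ 𝒮.causalFutureOf q}

/-- `U` is causally convex: causal curves joining two points of `U` stay in `U`. -/
def IsCausallyConvex (𝒮 : ConformalSpacetime n M) (U : Set M) : Prop :=
  ∀ (γ : ℝ → M) (a b : ℝ), a ≤ b → 𝒮.IsCausalCurve γ (Icc a b) → γ a ∈ U → γ b ∈ U →
    ∀ t ∈ Icc a b, γ t ∈ U

/-- Strong causality. -/
def IsStronglyCausal (𝒮 : ConformalSpacetime n M) : Prop :=
  ∀ p : M, ∀ U ∈ 𝓝 p, ∃ V ∈ 𝓝 p, V ⊆ U ∧ 𝒮.IsCausallyConvex V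

/-- Global hyperbolicity. -/
def IsGloballyHyperbolic (𝒮 : ConformalSpacetime n M) : Prop :=
  𝒮.IsStronglyCausal ∧ ∀ p q : M, IsCompact (𝒮.causalPastOf p ∩ 𝒮.causalFutureOf q)

/-- The curve `γ` on `J` is inextensible in the future: it has no future endpoint.  If `J` has a
last element `b`, then `γ b` is a future endpoint. -/
def IsFutureInextensible (γ : ℝ → M) (J : Set ℝ) : Prop :=
  ¬ ∃ q : M, Tendsto (fun t : J => γ t) atTop (𝓝 q)

/-- The curve `γ` on `J` is inextensible in the past: it has no past endpoint. -/
def IsPastInextensible (γ : ℝ → M) (J : Set ℝ) : Prop :=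
  ¬ ∃ q : M, Tendsto (fun t : J => γ t) atBot (𝓝 q)

/-- `S` is a topological hypersurface: near each of its points it is, in some topological chart of
`M`, a hyperplane section. -/
def IsTopologicalHypersurface (n : ℕ) {M : Type*} [TopologicalSpace M] (S : Set M) : Prop :=
  ∀ p ∈ S, ∃ (e : OpenPartialHomeomorph M (EuclideanSpace ℝ (Fin n)))
    (l : EuclideanSpace ℝ (Fin n) →L[ℝ] ℝ), p ∈ e.source ∧ l ≠ 0 ∧
    ∀ x ∈ e.source, x ∈ S ↔ l (e x) = 0

/-- Cauchy hypersurfaces: topological hypersurfaces that every inextensible causal curve meets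
exactly once. -/
def IsCauchyHypersurface (𝒮 : ConformalSpacetime n M) (S : Set M) : Prop :=
  IsTopologicalHypersurface n S ∧
    ∀ (γ : ℝ → M) (J : Set ℝ), 𝒮.IsCausalCurve γ J → IsFutureInextensible γ J →
      IsPastInextensible γ J → ∃! t, t ∈ J ∧ γ t ∈ S

/-- Open past sets. -/
def IsPastSet (𝒮 : ConformalSpacetime n M) (U : Set M) : Prop :=
  IsOpen U ∧ 𝒮.chronPast U ⊆ U

/-- Indecomposable past sets (IPs): nonempty open past sets that are not the union of two proper
open past subsets. -/
def IsIP (𝒮 : ConformalSpacetime n M) (U : Set M) : Prop :=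
  U.Nonempty ∧ 𝒮.IsPastSet U ∧
    ∀ V W : Set M, 𝒮.IsPastSet V → 𝒮.IsPastSet W → U = V ∪ W → V = U ∨ W = U

/-- Terminal indecomposable past sets (TIPs): IPs that are the chronological past of a causal curve
inextensible in the future. -/
def IsTIP (𝒮 : ConformalSpacetime n M) (P : Set M) : Prop :=
  𝒮.IsIP P ∧ ∃ (γ : ℝ → M) (J : Set ℝ), 𝒮.IsCausalCurve γ J ∧ IsFutureInextensible γ J ∧
    P = 𝒮.chronPast (γ '' J)

/-- The future causal boundary: the set of all TIPs. -/
def futureCausalBoundary (𝒮 : ConformalSpacetime n M) : Set (Set M) :=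
  {P | 𝒮.IsTIP P}

variable {N : Type*} [TopologicalSpace N]
  [ChartedSpace (EuclideanSpace ℝ (Fin n)) N] [IsManifold (𝓡 n) ∞ N]

/-- `f` is a conformal embedding of time-oriented conformal spacetimes: a smooth embedding, pulling
the conformal class back to the conformal class, and preserving the time-orientation. -/
structure IsConformalEmbedding (𝒮 : ConformalSpacetime n M) (𝒯 : ConformalSpacetime n N)
    (f : M → N) : Prop where
  isSmoothEmbedding : IsSmoothEmbedding (𝓡 n) (𝓡 n) ∞ f
  conformal : ∃ (g : LorentzianMetric n M) (h : LorentzianMetric n N),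
    𝒮.conformalClass.Contains g ∧ 𝒯.conformalClass.Contains h ∧
    ∃ φ : M → ℝ, ContMDiff (𝓡 n) 𝓘(ℝ, ℝ) ∞ φ ∧ ∀ (x : M) (v w : TangentSpace (𝓡 n) x),
      h.form (f x) (mfderiv (𝓡 n) (𝓡 n) f x v) (mfderiv (𝓡 n) (𝓡 n) f x w) =
        Real.exp (φ x) * g.form x v w
  map_future (x : M) (v : TangentSpace (𝓡 n) x) (hv : v ∈ 𝒮.future x) :
    mfderiv (𝓡 n) (𝓡 n) f x v ∈ 𝒯.future (f x)

/-- A conformal Cauchy-embedding: a conformal embedding sending every Cauchy hypersurface to a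
Cauchy hypersurface. -/
structure IsConformalCauchyEmbedding (𝒮 : ConformalSpacetime n M) (𝒯 : ConformalSpacetime n N)
    (f : M → N) : Prop extends IsConformalEmbedding 𝒮 𝒯 f where
  map_cauchy (S : Set M) (hS : 𝒮.IsCauchyHypersurface S) : 𝒯.IsCauchyHypersurface (f '' S)

/-- The future boundary `∂⁺f(M)` of the image of `f`: the points of the topological boundary of
`f(M)` in the chronological future of the image of a Cauchy hypersurface of `M`. -/
def futureBoundary (𝒮 : ConformalSpacetime n M) (𝒯 : ConformalSpacetime n N) (f : M → N) :
    Set N :=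
  {p | p ∈ frontier (range f) ∧ ∃ S : Set M, 𝒮.IsCauchyHypersurface S ∧
    p ∈ 𝒯.chronFuture (f '' S)}

end ConformalSpacetime

/-! The argument runs through the chronological relation `Chron`, whose past and future sets are
open.

Convexity of the image (`IsConformalCauchyEmbedding.mem_range`): let `x ≪ y ≪ z` with `x`, `z` in
`f(M)`. Extend a timelike curve through the three points to an inextensible curve `Γ` of `N`. Each
component of `Γ` inside the open set `f(M)` lifts to an inextensible curve of `M`, so it meets
`f(S)` for a Cauchy hypersurface `S` of `M`. Since `f(S)` is Cauchy in `N`, `Γ` meets it only once;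
so the components through `x` and `z` coincide, and this single interval contains the time of `y`.
Hence `f` also reflects `≪` (`chron_of_map`).

Terminal sets: a boundary point `p` lies outside the open set `f(M)` and is the end of a timelike
curve `γ` starting in `f(S)`. By convexity all of `γ` before `p` lies in `f(M)`, and its lift `δ`
has no endpoint in `M`. Openness of chronological futures gives `f⁻¹(I⁻(p)) = I⁻(δ)`; this set is
indecomposable because `δ` is totally ordered by `≪`.

Injectivity: if the set of `p` is contained in that of `q`, then `γ t ≪ q` for `0 < t < 1`. Causal
diamonds are closed, so `p ≤ q` in the limit; antisymmetry of the causal relation finishes the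
proof.

The extension to inextensible curves (`exists_inextensible`) rests on the order-theoretic
`exists_chain_not_tendsto`, whose separation hypothesis comes from closed diamonds. -/

namespace ConformalSpacetime

/-! ### Piecewise C¹ curves with velocities in a field of cones -/

section Curves

variable {n : ℕ} {M : Type*} [TopologicalSpace M]
  [ChartedSpace (EuclideanSpace ℝ (Fin n)) M]
  {K L : ∀ x : M, Set (TangentSpace (𝓡 n) x)} {γ γ' : ℝ → M} {a b : ℝ} {J J' : Set ℝ}

theorem uniqueMDiffWithinAt_Icc {a b t : ℝ} (hab : a < b) (ht : t ∈ Icc a b) :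
    UniqueMDiffWithinAt 𝓘(ℝ, ℝ) (Icc a b) t :=
  uniqueMDiffWithinAt_iff_uniqueDiffWithinAt.2 (uniqueDiffOn_Icc hab t ht)

theorem IsArc.mdifferentiableWithinAt (h : IsArc K γ a b) {t : ℝ} (ht : t ∈ Icc a b) :
    MDifferentiableWithinAt 𝓘(ℝ, ℝ) (𝓡 n) γ (Icc a b) t :=
  (h.1 t ht).mdifferentiableWithinAt one_ne_zero

theorem IsArc.subinterval (h : IsArc K γ a b) {c d : ℝ} (hac : a ≤ c) (hcd : c < d) (hdb : d ≤ b) :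
    IsArc K γ c d := by
  have hs : Icc c d ⊆ Icc a b := Icc_subset_Icc hac hdb
  refine ⟨h.1.mono hs, fun t ht => ?_⟩
  rw [mfderivWithin_subset hs (uniqueMDiffWithinAt_Icc hcd ht) (h.mdifferentiableWithinAt (hs ht))]
  exact h.2 t (hs ht)

/-- All tangent spaces are definitionally the model space; typing `v` there lets the base point be
replaced by an equal one without casts. -/
theorem mem_cone_of_eq {x y : M} (h : x = y) {v : EuclideanSpace ℝ (Fin n)}
    (hv : v ∈ (K x : Set (EuclideanSpace ℝ (Fin n)))) :
    v ∈ (K y : Set (EuclideanSpace ℝ (Fin n))) := h ▸ hv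

theorem IsArc.congr (h : IsArc K γ a b) (hγ : EqOn γ' γ (Icc a b)) : IsArc K γ' a b := by
  refine ⟨h.1.congr hγ, fun t ht => ?_⟩
  rw [mfderivWithin_congr_of_mem hγ ht]
  exact mem_cone_of_eq (hγ ht).symm (h.2 t ht)

theorem IsArc.mono_cone (h : IsArc K γ a b) (hKL : ∀ x, K x ⊆ L x) : IsArc L γ a b :=
  ⟨h.1, fun t ht => hKL _ (h.2 t ht)⟩

/-- The chain rule multiplies velocities by `α > 0`, hence the requirement that the cones be
positively homogeneous. -/
theorem IsArc.comp_affine (h : IsArc K γ a b) (hK : ∀ x, ∀ v ∈ K x, ∀ r : ℝ, 0 < r → r • v ∈ K x)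
    {α β c d : ℝ} (hα : 0 < α) (hcd : c < d) (hc : α * c + β = a) (hd : α * d + β = b) :
    IsArc K (fun t => γ (α * t + β)) c d := by
  have hs : MapsTo (fun t : ℝ => α * t + β) (Icc c d) (Icc a b) := by
    rintro t ⟨h1, h2⟩
    subst hc hd
    exact ⟨add_le_add_left (mul_le_mul_of_nonneg_left h1 hα.le) β,
      add_le_add_left (mul_le_mul_of_nonneg_left h2 hα.le) β⟩
  have hsm : ContMDiff 𝓘(ℝ, ℝ) 𝓘(ℝ, ℝ) 1 (fun t : ℝ => α * t + β) := by
    rw [contMDiff_iff_contDiff]; fun_prop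
  refine ⟨h.1.comp hsm.contMDiffOn hs, fun t ht => ?_⟩
  have h1 := mfderivWithin_comp (I := 𝓘(ℝ, ℝ)) (I' := 𝓘(ℝ, ℝ)) (I'' := 𝓡 n) t
    (h.mdifferentiableWithinAt (hs ht))
    ((hsm t).mdifferentiableAt one_ne_zero).mdifferentiableWithinAt hs
    (uniqueMDiffWithinAt_Icc hcd ht)
  have h2 : mfderivWithin 𝓘(ℝ, ℝ) 𝓘(ℝ, ℝ) (fun t : ℝ => α * t + β) (Icc c d) t (1 : ℝ)
      = α • (1 : ℝ) := by
    rw [mfderivWithin_eq_fderivWithin]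
    have : HasDerivWithinAt (fun t : ℝ => α * t + β) α (Icc c d) t := by
      simpa using ((hasDerivWithinAt_id t (Icc c d)).const_mul α).add_const β
    have h3 := this.hasFDerivWithinAt.fderivWithin (uniqueDiffOn_Icc hcd t ht)
    rw [h3, smul_eq_mul, mul_one]
    exact (by simp : ContinuousLinearMap.toSpanSingleton ℝ α (1 : ℝ) = α)
  have h4 : mfderivWithin 𝓘(ℝ, ℝ) (𝓡 n) (fun t => γ (α * t + β)) (Icc c d) t (1 : ℝ)
      = α • (mfderivWithin 𝓘(ℝ, ℝ) (𝓡 n) γ (Icc a b) (α * t + β) (1 : ℝ)) := by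
    have h5 := congrArg (fun F => F (1 : ℝ)) h1
    refine h5.trans ?_
    refine (congrArg (mfderivWithin 𝓘(ℝ, ℝ) (𝓡 n) γ (Icc a b) (α * t + β)) h2).trans ?_
    exact map_smul _ _ _
  rw [h4]
  exact hK _ _ (h.2 _ (hs ht)) α hα

theorem IsArc.map {N : Type*} [TopologicalSpace N] [ChartedSpace (EuclideanSpace ℝ (Fin n)) N]
    {L : ∀ x : N, Set (TangentSpace (𝓡 n) x)} {F : M → N}
    (h : IsArc K γ a b) (hab : a < b)
    (hF : ∀ t ∈ Icc a b, ContMDiffAt (𝓡 n) (𝓡 n) 1 F (γ t))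
    (hL : ∀ t ∈ Icc a b, ∀ v ∈ K (γ t), mfderiv (𝓡 n) (𝓡 n) F (γ t) v ∈ L (F (γ t))) :
    IsArc L (F ∘ γ) a b := by
  refine ⟨fun t ht => (hF t ht).comp_contMDiffWithinAt t (h.1 t ht), fun t ht => ?_⟩
  rw [mfderiv_comp_mfderivWithin t ((hF t ht).mdifferentiableAt one_ne_zero)
    (h.mdifferentiableWithinAt ht) (uniqueMDiffWithinAt_Icc hab ht)]
  exact hL t ht _ (h.2 t ht)

theorem IsCurve.congr (h : IsCurve K γ J) (hγ : EqOn γ' γ J) : IsCurve K γ' J := by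
  refine ⟨h.1, h.2.1, fun t ht => ⟨fun hs => ?_, fun hs => ?_⟩⟩
  · obtain ⟨s, hs, hts, harc⟩ := (h.2.2 t ht).1 hs
    exact ⟨s, hs, hts, harc.congr (hγ.mono (h.2.1.out ht hs))⟩
  · obtain ⟨s, hs, hts, harc⟩ := (h.2.2 t ht).2 hs
    exact ⟨s, hs, hts, harc.congr (hγ.mono (h.2.1.out hs ht))⟩

theorem IsCurve.mono_cone (h : IsCurve K γ J) (hKL : ∀ x, K x ⊆ L x) : IsCurve L γ J := by
  refine ⟨h.1, h.2.1, fun t ht => ⟨fun hs => ?_, fun hs => ?_⟩⟩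
  · obtain ⟨s, hs, hts, harc⟩ := (h.2.2 t ht).1 hs
    exact ⟨s, hs, hts, harc.mono_cone hKL⟩
  · obtain ⟨s, hs, hts, harc⟩ := (h.2.2 t ht).2 hs
    exact ⟨s, hs, hts, harc.mono_cone hKL⟩

theorem IsCurve.restrict (h : IsCurve K γ J) (hJ : J' ⊆ J) (hne : J'.Nonempty)
    (hJ' : J'.OrdConnected) : IsCurve K γ J' := by
  refine ⟨hne, hJ', fun t ht => ⟨?_, ?_⟩⟩
  · rintro ⟨u, hu, htu⟩
    obtain ⟨s, hs, hts, harc⟩ := (h.2.2 t (hJ ht)).1 ⟨u, hJ hu, htu⟩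
    exact ⟨min s u, hJ'.out ht hu ⟨le_min hts.le htu.le, min_le_right _ _⟩, lt_min hts htu,
      harc.subinterval le_rfl (lt_min hts htu) (min_le_left _ _)⟩
  · rintro ⟨u, hu, htu⟩
    obtain ⟨s, hs, hts, harc⟩ := (h.2.2 t (hJ ht)).2 ⟨u, hJ hu, htu⟩
    exact ⟨max s u, hJ'.out hu ht ⟨le_max_right _ _, max_le hts.le htu.le⟩, max_lt hts htu,
      harc.subinterval (le_max_left _ _) (max_lt hts htu) le_rfl⟩

theorem IsCurve.of_arc (h : IsArc K γ a b) (hab : a < b) : IsCurve K γ (Icc a b) := by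
  refine ⟨nonempty_Icc.2 hab.le, ordConnected_Icc, fun t ht => ⟨?_, ?_⟩⟩
  · rintro ⟨u, hu, htu⟩
    exact ⟨u, hu, htu, h.subinterval ht.1 htu hu.2⟩
  · rintro ⟨u, hu, htu⟩
    exact ⟨u, hu, htu, h.subinterval hu.1 htu ht.2⟩

/-- The defining condition concerns the two sides of a point separately, so no compatibility of
velocities is needed at the junction `c`. -/
theorem IsCurve.union {c : ℝ} (h : IsCurve K γ J) (h' : IsCurve K γ J') (hc : IsGreatest J c)
    (hc' : IsLeast J' c) : IsCurve K γ (J ∪ J') := by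
  refine ⟨h.1.inl, ⟨?_⟩, ?_⟩
  · rintro x hx y hy z hz
    rcases le_total z c with hzc | hzc
    · left
      rcases hx with hx | hx
      · exact h.2.1.out hx hc.1 ⟨hz.1, hzc⟩
      · have : z = c := le_antisymm hzc ((hc'.2 hx).trans hz.1)
        exact this ▸ hc.1
    · right
      rcases hy with hy | hy
      · have : z = c := le_antisymm (hz.2.trans (hc.2 hy)) hzc
        exact this ▸ hc'.1
      · exact h'.2.1.out hc'.1 hy ⟨hzc, hz.2⟩
  · rintro t ht
    refine ⟨?_, ?_⟩
    · rintro ⟨u, hu, htu⟩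
      by_cases hJ' : t ∈ J'
      · have hu' : u ∈ J' := hu.elim (fun hu => absurd htu
          (not_lt.2 ((hc.2 hu).trans (hc'.2 hJ')))) id
        obtain ⟨s, hs, hts, harc⟩ := (h'.2.2 t hJ').1 ⟨u, hu', htu⟩
        exact ⟨s, .inr hs, hts, harc⟩
      · have htJ : t ∈ J := ht.resolve_right hJ'
        have htc : t < c := lt_of_le_of_ne (hc.2 htJ) (fun e => hJ' (e ▸ hc'.1))
        obtain ⟨s, hs, hts, harc⟩ := (h.2.2 t htJ).1 ⟨c, hc.1, htc⟩
        exact ⟨s, .inl hs, hts, harc⟩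
    · rintro ⟨u, hu, htu⟩
      by_cases hJ : t ∈ J
      · have hu' : u ∈ J := hu.elim id (fun hu => absurd htu
          (not_lt.2 ((hc.2 hJ).trans (hc'.2 hu))))
        obtain ⟨s, hs, hts, harc⟩ := (h.2.2 t hJ).2 ⟨u, hu', htu⟩
        exact ⟨s, .inl hs, hts, harc⟩
      · have htJ : t ∈ J' := ht.resolve_left hJ
        have htc : c < t := lt_of_le_of_ne (hc'.2 htJ) (fun e => hJ (e ▸ hc.1))
        obtain ⟨s, hs, hts, harc⟩ := (h'.2.2 t htJ).2 ⟨c, hc'.1, htc⟩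
        exact ⟨s, .inr hs, hts, harc⟩

theorem IsCurve.continuousOn (h : IsCurve K γ J) : ContinuousOn γ J := by
  intro t ht
  have h1 : ContinuousWithinAt γ (J ∩ Ici t) t := by
    by_cases hs : ∃ s ∈ J, t < s
    · obtain ⟨s, hs, hts, harc⟩ := (h.2.2 t ht).1 hs
      have := (harc.1.continuousOn t (left_mem_Icc.2 hts.le))
      exact (this.mono_of_mem_nhdsWithin (Icc_mem_nhdsGE hts)).mono inter_subset_right
    · push Not at hs
      refine continuousWithinAt_singleton.mono (fun u hu => ?_)
      exact le_antisymm (hs u hu.1) hu.2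
  have h2 : ContinuousWithinAt γ (J ∩ Iic t) t := by
    by_cases hs : ∃ s ∈ J, s < t
    · obtain ⟨s, hs, hts, harc⟩ := (h.2.2 t ht).2 hs
      have := (harc.1.continuousOn t (right_mem_Icc.2 hts.le))
      exact (this.mono_of_mem_nhdsWithin (Icc_mem_nhdsLE hts)).mono inter_subset_right
    · push Not at hs
      refine continuousWithinAt_singleton.mono (fun u hu => ?_)
      exact le_antisymm hu.2 (hs u hu.1)
  refine (h1.union h2).mono (fun u hu => ?_)
  rcases le_total t u with h | h
  · exact .inl ⟨hu, h⟩
  · exact .inr ⟨hu, h⟩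

theorem IsCurve.comp_affine (h : IsCurve K γ J)
    (hK : ∀ x, ∀ v ∈ K x, ∀ r : ℝ, 0 < r → r • v ∈ K x)
    {α β : ℝ} (hα : 0 < α) (hJ : MapsTo (fun t => α * t + β) J' J)
    (hJ' : J'.OrdConnected) (hne : J'.Nonempty) :
    IsCurve K (fun t => γ (α * t + β)) J' := by
  have key : ∀ s : ℝ, α * ((s - β) / α) + β = s := fun s => by field_simp; ring
  have hinv : ∀ s t : ℝ, α * t + β < s → t < (s - β) / α := fun s t hst => by
    rw [lt_div_iff₀ hα]; linarith
  have hinv' : ∀ s t : ℝ, s < α * t + β → (s - β) / α < t := fun s t hst => by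
    rw [div_lt_iff₀ hα]; linarith
  refine ⟨hne, hJ', fun t ht => ⟨?_, ?_⟩⟩
  · rintro ⟨u, hu, htu⟩
    obtain ⟨s, hs, hts, harc⟩ := (h.2.2 _ (hJ ht)).1 ⟨_, hJ hu, add_lt_add_left (mul_lt_mul_of_pos_left htu hα) β⟩
    have hts' := hinv s t hts
    refine ⟨min ((s - β) / α) u, hJ'.out ht hu ⟨le_min hts'.le htu.le, min_le_right _ _⟩,
      lt_min hts' htu, (harc.comp_affine hK hα hts' rfl (key s)).subinterval le_rfl
        (lt_min hts' htu) (min_le_left _ _)⟩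
  · rintro ⟨u, hu, htu⟩
    obtain ⟨s, hs, hts, harc⟩ := (h.2.2 _ (hJ ht)).2 ⟨_, hJ hu, add_lt_add_left (mul_lt_mul_of_pos_left htu hα) β⟩
    have hts' := hinv' s t hts
    refine ⟨max ((s - β) / α) u, hJ'.out hu ht ⟨le_max_right _ _, max_le hts'.le htu.le⟩,
      max_lt hts' htu, (harc.comp_affine hK hα hts' (key s) rfl).subinterval (le_max_left _ _)
        (max_lt hts' htu) le_rfl⟩

theorem IsCurve.map {N : Type*} [TopologicalSpace N] [ChartedSpace (EuclideanSpace ℝ (Fin n)) N]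
    {L : ∀ x : N, Set (TangentSpace (𝓡 n) x)} {F : M → N}
    (h : IsCurve K γ J) (hF : ∀ t ∈ J, ContMDiffAt (𝓡 n) (𝓡 n) 1 F (γ t))
    (hL : ∀ t ∈ J, ∀ v ∈ K (γ t), mfderiv (𝓡 n) (𝓡 n) F (γ t) v ∈ L (F (γ t))) :
    IsCurve L (F ∘ γ) J := by
  refine ⟨h.1, h.2.1, fun t ht => ⟨fun hs => ?_, fun hs => ?_⟩⟩
  · obtain ⟨s, hs, hts, harc⟩ := (h.2.2 t ht).1 hs
    have hsub := h.2.1.out ht hs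
    exact ⟨s, hs, hts, harc.map hts (fun u hu => hF u (hsub hu)) (fun u hu => hL u (hsub hu))⟩
  · obtain ⟨s, hs, hts, harc⟩ := (h.2.2 t ht).2 hs
    have hsub := h.2.1.out hs ht
    exact ⟨s, hs, hts, harc.map hts (fun u hu => hF u (hsub hu)) (fun u hu => hL u (hsub hu))⟩

/-- Turns a bi-infinite chain of segments into one curve defined on all of `ℝ`, the `k`-th segment
being run through on `[k, k + 1]`. -/
theorem IsCurve.glue_int (hK : ∀ x, ∀ v ∈ K x, ∀ r : ℝ, 0 < r → r • v ∈ K x)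
    {c : ℤ → ℝ → M} (hc : ∀ k, IsCurve K (c k) (Icc 0 1)) (hcc : ∀ k, c k 1 = c (k + 1) 0) :
    IsCurve K (fun t => c ⌊t⌋ (Int.fract t)) univ := by
  have key : ∀ k : ℤ, IsCurve K (fun t => c ⌊t⌋ (Int.fract t)) (Icc (k : ℝ) (k + 1)) := by
    intro k
    have h1 : IsCurve K (fun t => c k (1 * t + (-k))) (Icc (k : ℝ) (k + 1)) :=
      (hc k).comp_affine hK one_pos
        (fun t ht => ⟨by simpa using ht.1, by have := ht.2; simp; linarith⟩)
        ordConnected_Icc (nonempty_Icc.2 (by linarith))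
    refine h1.congr (fun t ht => ?_)
    -- At `t = k + 1` the floor already selects the next segment; `hcc` makes the two values agree.
    rcases ht.2.eq_or_lt with rfl | hlt
    · have h2 : ⌊(k : ℝ) + 1⌋ = k + 1 := by
        rw [Int.floor_eq_iff]; push_cast; constructor <;> linarith
      have h3 : Int.fract ((k : ℝ) + 1) = 0 := by rw [Int.fract, h2]; push_cast; ring
      simp only [h2, h3, ← hcc]
      congr 1; ring
    · have h2 : ⌊t⌋ = k := by
        rw [Int.floor_eq_iff]; exact ⟨ht.1, hlt⟩
      have h3 : Int.fract t = t - k := by rw [Int.fract, h2]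
      simp only [h2, h3]
      congr 1; ring
  refine ⟨univ_nonempty, ordConnected_univ, fun t _ => ⟨fun _ => ?_, fun _ => ?_⟩⟩
  · obtain ⟨s, -, hs⟩ := ((key ⌊t⌋).2.2 t ⟨Int.floor_le t, (Int.lt_floor_add_one t).le⟩).1
      ⟨⌊t⌋ + 1, right_mem_Icc.2 (by linarith), Int.lt_floor_add_one t⟩
    exact ⟨s, mem_univ _, hs⟩
  · have h1 := Int.ceil_lt_add_one t
    have h2 := Int.le_ceil t
    obtain ⟨s, -, hs⟩ := ((key (⌈t⌉ - 1)).2.2 t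
      ⟨by push_cast; linarith, by push_cast; linarith⟩).2
      ⟨((⌈t⌉ - 1 : ℤ) : ℝ), left_mem_Icc.2 (by linarith), by push_cast; linarith⟩
    exact ⟨s, mem_univ _, hs⟩

end Curves

end ConformalSpacetime

/-! ### Concatenation, time cones and the chronological relation -/

namespace ConformalSpacetime

section Concatenation

variable {n : ℕ} {M : Type*} [TopologicalSpace M]
  [ChartedSpace (EuclideanSpace ℝ (Fin n)) M]
  {K : ∀ x : M, Set (TangentSpace (𝓡 n) x)} {γ γ' : ℝ → M} {a b c d : ℝ}

theorem IsCurve.exists_concat (hK : ∀ x, ∀ v ∈ K x, ∀ r : ℝ, 0 < r → r • v ∈ K x)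
    (h : IsCurve K γ (Icc a b)) (h' : IsCurve K γ' (Icc c d)) (hab : a ≤ b) (hcd : c ≤ d)
    (hbc : γ b = γ' c) :
    ∃ δ : ℝ → M, IsCurve K δ (Icc a (b + (d - c))) ∧ δ a = γ a ∧ δ b = γ b ∧
      δ (b + (d - c)) = γ' d := by
  set δ : ℝ → M := fun t => if t ≤ b then γ t else γ' (1 * t + (c - b)) with hδ
  have e1 : EqOn δ γ (Icc a b) := fun t ht => if_pos ht.2
  have e2 : EqOn δ (fun t => γ' (1 * t + (c - b))) (Icc b (b + (d - c))) := by
    intro t ht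
    rcases ht.1.eq_or_lt with rfl | hlt
    · simp only [hδ, le_refl, if_true, hbc]
      congr 1; ring
    · exact if_neg (not_le.2 hlt)
  have h1 : IsCurve K δ (Icc a b) := h.congr e1
  have h2 : IsCurve K δ (Icc b (b + (d - c))) := by
    refine IsCurve.congr (h'.comp_affine hK one_pos ?_ ordConnected_Icc
      (nonempty_Icc.2 (by linarith))) e2
    rintro t ⟨h3, h4⟩
    constructor <;> linarith
  refine ⟨δ, ?_, e1 (left_mem_Icc.2 hab), e1 (right_mem_Icc.2 hab), ?_⟩
  · have := h1.union h2 (isGreatest_Icc hab) (isLeast_Icc (by linarith))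
    rwa [Icc_union_Icc_eq_Icc hab (by linarith)] at this
  · rw [e2 (right_mem_Icc.2 (by linarith))]
    simp only
    congr 1; ring

end Concatenation

section Cones

variable {n : ℕ} {M : Type*} [TopologicalSpace M]
  [ChartedSpace (EuclideanSpace ℝ (Fin n)) M] [IsManifold (𝓡 n) ∞ M]

/-- Two metrics of the class differ by the positive factor `exp φ`, so any representative detects
timelike vectors. -/
theorem mem_timelikeCone_iff {C : ConformalClass n M} {g : LorentzianMetric n M}
    (hg : C.Contains g) {x : M} {v : TangentSpace (𝓡 n) x} :
    v ∈ C.timelikeCone x ↔ g.form x v v < 0 := by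
  refine ⟨?_, fun h => ⟨g, hg, h⟩⟩
  rintro ⟨g', hg', h⟩
  obtain ⟨φ, -, hφ⟩ : LorentzianMetric.ConformallyEquivalent g g' :=
    Quotient.exact (hg.trans hg'.symm)
  rw [hφ] at h
  exact (pos_iff_neg_of_mul_neg h).1 (Real.exp_pos _)

variable (𝒮 : ConformalSpacetime n M)

theorem future_eq_component {x : M} {v : TangentSpace (𝓡 n) x} (hv : v ∈ 𝒮.future x) :
    𝒮.future x = connectedComponentIn (𝒮.conformalClass.timelikeCone x) v := by
  obtain ⟨w, -, hw⟩ := 𝒮.future_component x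
  rw [hw] at hv ⊢
  exact connectedComponentIn_eq hv

theorem future_subset_timelikeCone (x : M) :
    𝒮.future x ⊆ 𝒮.conformalClass.timelikeCone x := by
  obtain ⟨w, -, hw⟩ := 𝒮.future_component x
  rw [hw]
  exact connectedComponentIn_subset _ _

theorem future_nonempty (x : M) : (𝒮.future x).Nonempty := by
  obtain ⟨w, hw, h⟩ := 𝒮.future_component x
  exact ⟨w, h ▸ mem_connectedComponentIn hw⟩

/-- The open ray through `v` is connected and timelike, since the form scales by a square; so it
stays in one component. -/
theorem smul_mem_future (x : M) (v : TangentSpace (𝓡 n) x) (hv : v ∈ 𝒮.future x) (r : ℝ)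
    (hr : 0 < r) : r • v ∈ 𝒮.future x := by
  rw [𝒮.future_eq_component hv]
  have hc : ContinuousOn (fun s : ℝ => s • v) (Ioi 0) := by fun_prop
  have hpre : IsPreconnected ((fun s : ℝ => s • v) '' Ioi 0) := isPreconnected_Ioi.image _ hc
  refine hpre.subset_connectedComponentIn ⟨1, mem_Ioi.2 one_pos, one_smul _ _⟩ ?_ ⟨r, hr, rfl⟩
  rintro _ ⟨s, hs, rfl⟩
  obtain ⟨g, hg, h⟩ := 𝒮.future_subset_timelikeCone x hv
  refine ⟨g, hg, ?_⟩
  simp only [map_smul, smul_apply, smul_eq_mul]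
  have hs' : (0 : ℝ) < s := hs
  nlinarith [mul_pos hs' hs']

theorem smul_mem_causalFuture (x : M) (v : TangentSpace (𝓡 n) x) (hv : v ∈ 𝒮.causalFuture x)
    (r : ℝ) (hr : 0 < r) : r • v ∈ 𝒮.causalFuture x :=
  ⟨smul_ne_zero hr.ne' hv.1, map_mem_closure (continuous_const_smul r) hv.2
    (fun w hw => 𝒮.smul_mem_future x w hw r hr)⟩

theorem future_subset_causalFuture (x : M) : 𝒮.future x ⊆ 𝒮.causalFuture x := by
  intro v hv
  refine ⟨?_, subset_closure hv⟩
  rintro rfl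
  obtain ⟨g, -, h⟩ := 𝒮.future_subset_timelikeCone x hv
  simp at h

variable {𝒮} in
theorem IsTimelikeCurve.isCausalCurve {γ : ℝ → M} {J : Set ℝ} (h : 𝒮.IsTimelikeCurve γ J) :
    𝒮.IsCausalCurve γ J :=
  IsCurve.mono_cone h 𝒮.future_subset_causalFuture

/-- The chronological relation `x ≪ y`. -/
def Chron (x y : M) : Prop :=
  ∃ γ : ℝ → M, 𝒮.IsTimelikeCurve γ (Icc 0 1) ∧ γ 0 = x ∧ γ 1 = y

variable {𝒮}

theorem IsTimelikeCurve.chron {γ : ℝ → M} {J : Set ℝ} (h : 𝒮.IsTimelikeCurve γ J) {a b : ℝ}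
    (ha : a ∈ J) (hb : b ∈ J) (hab : a < b) : 𝒮.Chron (γ a) (γ b) := by
  have h1 : IsCurve 𝒮.future (fun t => γ ((b - a) * t + a)) (Icc 0 1) := by
    refine IsCurve.comp_affine (J := Icc a b) (IsCurve.restrict h (h.2.1.out ha hb)
      (nonempty_Icc.2 hab.le) ordConnected_Icc) 𝒮.smul_mem_future (sub_pos.2 hab) ?_
      ordConnected_Icc (nonempty_Icc.2 zero_le_one)
    rintro t ⟨h1, h2⟩
    constructor <;> simp only <;> nlinarith
  exact ⟨_, h1, by simp, by simp⟩

theorem Chron.trans {x y z : M} (h : 𝒮.Chron x y) (h' : 𝒮.Chron y z) : 𝒮.Chron x z := by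
  obtain ⟨γ, hγ, rfl, rfl⟩ := h
  obtain ⟨γ', hγ', h0, rfl⟩ := h'
  obtain ⟨δ, hδ, h1, -, h2⟩ := IsCurve.exists_concat 𝒮.smul_mem_future hγ hγ' zero_le_one
    zero_le_one h0.symm
  rw [← h1, ← h2]
  exact IsTimelikeCurve.chron hδ (left_mem_Icc.2 (by norm_num)) (right_mem_Icc.2 (by norm_num))
    (by norm_num)

theorem mem_chronFuture_iff {A : Set M} {q : M} :
    q ∈ 𝒮.chronFuture A ↔ ∃ p ∈ A, 𝒮.Chron p q := by
  constructor
  · rintro ⟨p, hp, γ, a, b, hab, hγ, rfl, rfl⟩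
    exact ⟨_, hp, hγ.chron (left_mem_Icc.2 hab.le) (right_mem_Icc.2 hab.le) hab⟩
  · rintro ⟨p, hp, γ, hγ, h0, h1⟩
    exact ⟨p, hp, γ, 0, 1, one_pos, hγ, h0, h1⟩

theorem mem_chronPast_iff {A : Set M} {p : M} :
    p ∈ 𝒮.chronPast A ↔ ∃ q ∈ A, 𝒮.Chron p q := by
  constructor
  · rintro ⟨p, hp, γ, a, b, hab, hγ, rfl, rfl⟩
    exact ⟨_, hp, hγ.chron (left_mem_Icc.2 hab.le) (right_mem_Icc.2 hab.le) hab⟩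
  · rintro ⟨p, hp, γ, hγ, h0, h1⟩
    exact ⟨p, hp, γ, 0, 1, one_pos, hγ, h0, h1⟩

theorem Chron.mem_causalFutureOf {x y : M} (h : 𝒮.Chron x y) : y ∈ 𝒮.causalFutureOf x := by
  obtain ⟨γ, hγ, h0, h1⟩ := h
  exact ⟨γ, 0, 1, zero_le_one, hγ.isCausalCurve, h0, h1⟩

/-- A strongly causal spacetime contains no closed causal curves through two distinct points. -/
theorem IsStronglyCausal.antisymm [T1Space M] (hS : 𝒮.IsStronglyCausal) {p q : M}
    (h : q ∈ 𝒮.causalFutureOf p) (h' : p ∈ 𝒮.causalFutureOf q) : p = q := by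
  by_contra hne
  -- A causally convex neighbourhood of `p` that avoids `q` would have to contain the whole loop
  -- from `p` through `q` back to `p`.
  obtain ⟨V, hV, hVU, hconv⟩ := hS p {q}ᶜ (isOpen_compl_singleton.mem_nhds hne)
  obtain ⟨γ, a, b, hab, hγ, rfl, rfl⟩ := h
  obtain ⟨γ', c, d, hcd, hγ', h0, h1⟩ := h'
  obtain ⟨δ, hδ, h2, h3, h4⟩ := IsCurve.exists_concat 𝒮.smul_mem_causalFuture hγ hγ' hab hcd h0.symm
  have h5 := hconv δ a (b + (d - c)) (by linarith) hδ (by rw [h2]; exact mem_of_mem_nhds hV)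
    (by rw [h4, h1]; exact mem_of_mem_nhds hV) b ⟨hab, by linarith⟩
  rw [h3] at h5
  exact hVU h5 rfl

end Cones

end ConformalSpacetime

/-! ### Local chronology in charts: openness of chronological pasts and futures -/

namespace ConformalSpacetime

section Local

variable {n : ℕ} {M : Type*} [TopologicalSpace M]
  [ChartedSpace (EuclideanSpace ℝ (Fin n)) M] [IsManifold (𝓡 n) ∞ M]
  (𝒮 : ConformalSpacetime n M)

/-- Near `q`, vectors with almost the same chart components as a future vector at `q` are
future vectors. -/
theorem exists_ball_mfderivWithin_mem_future {q : M} {v : EuclideanSpace ℝ (Fin n)}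
    (hv : v ∈ (𝒮.future q : Set (EuclideanSpace ℝ (Fin n)))) :
    ∃ ε > 0, Metric.ball (extChartAt (𝓡 n) q q) ε ⊆ (extChartAt (𝓡 n) q).target ∧
      ∀ x ∈ Metric.ball (extChartAt (𝓡 n) q q) ε, ∀ w ∈ Metric.ball v ε,
        mfderivWithin 𝓘(ℝ, EuclideanSpace ℝ (Fin n)) (𝓡 n) (extChartAt (𝓡 n) q).symm
          (extChartAt (𝓡 n) q).target x w ∈ 𝒮.future ((extChartAt (𝓡 n) q).symm x) := by
  set φ := extChartAt (𝓡 n) q with hφ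
  have hopen : IsOpen φ.target := isOpen_extChartAt_target q
  have hq : φ q ∈ φ.target := mem_extChartAt_target q
  have hsm : ContMDiffOn 𝓘(ℝ, EuclideanSpace ℝ (Fin n)) (𝓡 n) ∞ φ.symm φ.target :=
    contMDiffOn_extChartAt_symm q
  have hcont := hsm.continuousOn_tangentMapWithin (by simp) hopen.uniqueMDiffOn
  set Ψ : EuclideanSpace ℝ (Fin n) × EuclideanSpace ℝ (Fin n) → TangentBundle (𝓡 n) M :=
    fun p => tangentMapWithin 𝓘(ℝ, EuclideanSpace ℝ (Fin n)) (𝓡 n) φ.symm φ.target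
      ((tangentBundleModelSpaceHomeomorph 𝓘(ℝ, EuclideanSpace ℝ (Fin n))).symm p) with hΨ
  have hΨc : ContinuousOn Ψ (φ.target ×ˢ univ) := by
    refine hcont.comp (Homeomorph.continuous _).continuousOn ?_
    rintro ⟨x, w⟩ ⟨hx, -⟩
    exact hx
  have hmem : Ψ (φ q, v) ∈ {w : TangentBundle (𝓡 n) M | w.2 ∈ 𝒮.future w.1} := by
    -- The tangent space at `q` is identified with the model space by the preferred chart at `q`, so
    -- in that chart the derivative at `q` is the identity.
    have h1 : mfderivWithin 𝓘(ℝ, EuclideanSpace ℝ (Fin n)) (𝓡 n) φ.symm φ.target (φ q)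
        = ContinuousLinearMap.id ℝ (EuclideanSpace ℝ (Fin n)) := by
      rw [mfderivWithin_of_mem_nhds (hopen.mem_nhds hq)]
      have := mfderivWithin_range_extChartAt_symm (I := 𝓡 n) (x := q)
      rw [ModelWithCorners.range_eq_univ, mfderivWithin_univ] at this
      exact this
    have h2 : mfderivWithin 𝓘(ℝ, EuclideanSpace ℝ (Fin n)) (𝓡 n) φ.symm φ.target (φ q) v = v :=
      congrArg (fun F : EuclideanSpace ℝ (Fin n) →L[ℝ] EuclideanSpace ℝ (Fin n) => F v) h1
    change mfderivWithin 𝓘(ℝ, EuclideanSpace ℝ (Fin n)) (𝓡 n) φ.symm φ.target (φ q) v ∈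
      𝒮.future (φ.symm (φ q))
    exact mem_cone_of_eq (K := 𝒮.future) (extChartAt_to_inv (I := 𝓡 n) q).symm
      (Set.mem_of_eq_of_mem h2 hv)
  have hdom : φ.target ×ˢ univ ∈ 𝓝 (φ q, v) := (hopen.prod isOpen_univ).mem_nhds ⟨hq, mem_univ v⟩
  have hcat : ContinuousAt Ψ (φ q, v) := hΨc.continuousAt hdom
  have hnhds : ∀ᶠ p in 𝓝 (φ q, v), Ψ p ∈ {w : TangentBundle (𝓡 n) M | w.2 ∈ 𝒮.future w.1} :=
    hcat.eventually (𝒮.future_isOpen.mem_nhds hmem)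
  obtain ⟨ε, hε, hball⟩ := Metric.eventually_nhds_iff_ball.1 (hnhds.and hdom)
  rw [← ball_prod_same] at hball
  refine ⟨ε, hε, fun x hx => (hball (x, v) ⟨hx, Metric.mem_ball_self hε⟩).2.1, ?_⟩
  intro x hx w hw
  have h3 := (hball (x, w) (mk_mem_prod hx hw)).1
  exact h3

/-- Near `q`, points whose chart difference is almost a positive multiple of a future vector at `q`
are chronologically related. -/
theorem exists_ball_chron {q : M} {v : EuclideanSpace ℝ (Fin n)}
    (hv : v ∈ (𝒮.future q : Set (EuclideanSpace ℝ (Fin n)))) :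
    ∃ ε > 0, ∀ x ∈ (extChartAt (𝓡 n) q).source, ∀ y ∈ (extChartAt (𝓡 n) q).source,
      extChartAt (𝓡 n) q x ∈ Metric.ball (extChartAt (𝓡 n) q q) ε →
      extChartAt (𝓡 n) q y ∈ Metric.ball (extChartAt (𝓡 n) q q) ε →
      ∀ τ : ℝ, 0 < τ → τ⁻¹ • (extChartAt (𝓡 n) q y - extChartAt (𝓡 n) q x) ∈ Metric.ball v ε →
        𝒮.Chron x y := by
  obtain ⟨ε, hε, hsub, hfut⟩ := 𝒮.exists_ball_mfderivWithin_mem_future hv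
  refine ⟨ε, hε, fun x hx y hy hxb hyb τ hτ hw => ?_⟩
  set φ := extChartAt (𝓡 n) q with hφ
  set w := τ⁻¹ • (φ y - φ x) with hwdef
  -- The connecting curve is the chart segment run in time `τ` with constant velocity `w`; convexity
  -- of the ball keeps it where `hfut` applies.
  set l : ℝ → EuclideanSpace ℝ (Fin n) := fun t => φ x + t • w with hl
  have hlτ : l τ = φ y := by
    simp only [hl, hwdef, smul_smul, mul_inv_cancel₀ hτ.ne', one_smul]
    abel
  have hl0 : l 0 = φ x := by simp [hl]
  have hlball : MapsTo l (Icc 0 τ) (Metric.ball (φ q) ε) := by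
    intro t ht
    have : l t = (1 - t / τ) • φ x + (t / τ) • φ y := by
      rw [← hlτ]
      simp only [hl, smul_add, smul_smul, div_mul_cancel₀ _ hτ.ne', sub_smul, one_smul]
      abel
    rw [this]
    refine (convex_ball (φ q) ε) hxb hyb ?_ (div_nonneg ht.1 hτ.le) (by ring)
    rw [sub_nonneg, div_le_one hτ]
    exact ht.2
  have hsm : ContMDiffOn 𝓘(ℝ, EuclideanSpace ℝ (Fin n)) (𝓡 n) 1 φ.symm φ.target :=
    (contMDiffOn_extChartAt_symm (n := ∞) q).of_le (by simp)
  have hlsm : ContMDiff 𝓘(ℝ, ℝ) 𝓘(ℝ, EuclideanSpace ℝ (Fin n)) 1 l := by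
    rw [contMDiff_iff_contDiff]; fun_prop
  have hmaps : MapsTo l (Icc 0 τ) φ.target := hlball.mono_right hsub
  have harc : IsArc 𝒮.future (φ.symm ∘ l) 0 τ := by
    refine ⟨hsm.comp hlsm.contMDiffOn hmaps, fun t ht => ?_⟩
    rw [mfderivWithin_comp t ((hsm _ (hmaps ht)).mdifferentiableWithinAt one_ne_zero)
      ((hlsm t).mdifferentiableAt one_ne_zero).mdifferentiableWithinAt hmaps
      (uniqueMDiffWithinAt_Icc hτ ht)]
    have h2 : mfderivWithin 𝓘(ℝ, ℝ) 𝓘(ℝ, EuclideanSpace ℝ (Fin n)) l (Icc 0 τ) t (1 : ℝ) = w := by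
      rw [mfderivWithin_eq_fderivWithin]
      have : HasDerivWithinAt l w (Icc 0 τ) t := by
        have h3 := ((hasDerivWithinAt_id t (Icc 0 τ)).smul_const w).const_add (φ x)
        rw [one_smul] at h3
        exact h3
      have h3 := this.hasFDerivWithinAt.fderivWithin (uniqueDiffOn_Icc hτ t ht)
      rw [h3]
      exact (by simp : ContinuousLinearMap.toSpanSingleton ℝ w (1 : ℝ) = w)
    have h3 := hfut (l t) (hlball ht) w hw
    rw [← h2] at h3
    exact h3
  have := IsTimelikeCurve.chron (IsCurve.of_arc harc hτ) (left_mem_Icc.2 hτ.le)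
    (right_mem_Icc.2 hτ.le) hτ
  simp only [Function.comp, hl0, hlτ] at this
  rwa [φ.left_inv hx, φ.left_inv hy] at this

variable {𝒮}

/-- The difference quotients in a chart of an arc at one of its points converge to the velocity. -/
theorem IsArc.tendsto_slope {K : ∀ x : M, Set (TangentSpace (𝓡 n) x)} {γ : ℝ → M} {a b t₀ : ℝ}
    (h : IsArc K γ a b) (hab : a < b) (ht₀ : t₀ ∈ Icc a b) :
    ∃ v : EuclideanSpace ℝ (Fin n), v ∈ (K (γ t₀) : Set (EuclideanSpace ℝ (Fin n))) ∧
      Tendsto (slope (extChartAt (𝓡 n) (γ t₀) ∘ γ) t₀) (𝓝[Icc a b \ {t₀}] t₀) (𝓝 v) := by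
  set φ := extChartAt (𝓡 n) (γ t₀) with hφ
  have hφd : MDifferentiableAt (𝓡 n) 𝓘(ℝ, EuclideanSpace ℝ (Fin n)) φ (γ t₀) :=
    mdifferentiableAt_extChartAt (mem_chart_source _ _)
  have hd := h.mdifferentiableWithinAt ht₀
  have hcomp := mfderiv_comp_mfderivWithin t₀ hφd hd (uniqueMDiffWithinAt_Icc hab ht₀)
  have hdc : MDifferentiableWithinAt 𝓘(ℝ, ℝ) 𝓘(ℝ, EuclideanSpace ℝ (Fin n)) (φ ∘ γ)
    (Icc a b) t₀ := hφd.comp_mdifferentiableWithinAt t₀ hd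
  have hF := (mdifferentiableWithinAt_iff_differentiableWithinAt.1 hdc).hasFDerivWithinAt
  rw [← mfderivWithin_eq_fderivWithin, hcomp] at hF
  have hD := hasDerivWithinAt_iff_tendsto_slope.1 hF.hasDerivWithinAt
  refine ⟨_, h.2 t₀ ht₀, ?_⟩
  convert hD using 1
  refine congrArg 𝓝 ?_
  have h1 : mfderiv (𝓡 n) 𝓘(ℝ, EuclideanSpace ℝ (Fin n)) φ (γ t₀)
      = ContinuousLinearMap.id ℝ (EuclideanSpace ℝ (Fin n)) := mfderiv_extChartAt_self
  exact (congrArg (fun F : EuclideanSpace ℝ (Fin n) →L[ℝ] EuclideanSpace ℝ (Fin n) =>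
    F (mfderivWithin 𝓘(ℝ, ℝ) (𝓡 n) γ (Icc a b) t₀ (1 : ℝ))) h1).symm

theorem eventually_chart_mem_ball {M : Type*} [TopologicalSpace M]
    [ChartedSpace (EuclideanSpace ℝ (Fin n)) M] (q : M) {ε : ℝ} (hε : 0 < ε) : ∀ᶠ x in 𝓝 q,
    x ∈ (extChartAt (𝓡 n) q).source ∧
      extChartAt (𝓡 n) q x ∈ Metric.ball (extChartAt (𝓡 n) q q) ε :=
  Filter.Eventually.and (extChartAt_source_mem_nhds q)
    ((continuousAt_extChartAt q).preimage_mem_nhds (Metric.ball_mem_nhds _ hε))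

/-- Near the end of the curve, the difference quotient from `γ t` to `γ 1` in the chart is close to
the final velocity. For fixed `t` this persists when `γ 1` is replaced by a nearby `y`, so `γ t ≪ y`
by `exists_ball_chron`. -/
theorem isOpen_setOf_chron_right (p : M) : IsOpen {q | 𝒮.Chron p q} := by
  rw [isOpen_iff_mem_nhds]
  rintro q ⟨γ, hγ, rfl, rfl⟩
  obtain ⟨s, hs, hs1, harc⟩ := (hγ.2.2 1 (right_mem_Icc.2 zero_le_one)).2
    ⟨0, left_mem_Icc.2 zero_le_one, one_pos⟩
  obtain ⟨v, hv, hslope⟩ := harc.tendsto_slope hs1 (right_mem_Icc.2 hs1.le)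
  obtain ⟨ε, hε, hchron⟩ := 𝒮.exists_ball_chron hv
  have hne : (𝓝[Icc s 1 \ {1}] (1 : ℝ)).NeBot := by
    rw [Icc_sdiff_right]; exact right_nhdsWithin_Ico_neBot hs1
  have hγc : Tendsto γ (𝓝[Icc s 1 \ {1}] 1) (𝓝 (γ 1)) :=
    (harc.1.continuousOn 1 (right_mem_Icc.2 hs1.le)).mono_left (nhdsWithin_mono _ sdiff_subset)
  obtain ⟨t, ⟨⟨ht, ht1⟩, hsl⟩, htb⟩ := ((eventually_mem_nhdsWithin.and
    (hslope.eventually (Metric.ball_mem_nhds v hε))).and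
    (hγc.eventually (eventually_chart_mem_ball (n := n) _ hε))).exists
  have ht1' : t < 1 := lt_of_le_of_ne ht.2 ht1
  have ht0 : s < t ∨ s = t := ht.1.lt_or_eq
  set φ := extChartAt (𝓡 n) (γ 1) with hφ
  have hcont : ContinuousAt (fun y => (1 - t)⁻¹ • (φ y - φ (γ t))) (γ 1) :=
    ContinuousAt.const_smul (g := fun y => φ y - φ (γ t))
      ((continuousAt_extChartAt (γ 1)).sub continuousAt_const) (1 - t)⁻¹
  have hmem : (1 - t)⁻¹ • (φ (γ 1) - φ (γ t)) ∈ Metric.ball v ε := by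
    rw [slope_comm] at hsl
    simpa [slope_def_module] using hsl
  filter_upwards [eventually_chart_mem_ball (n := n) (γ 1) hε,
    hcont.preimage_mem_nhds (Metric.isOpen_ball.mem_nhds hmem)] with y hy hy'
  have hty : 𝒮.Chron (γ t) y :=
    hchron _ htb.1 _ hy.1 htb.2 hy.2 (1 - t) (sub_pos.2 ht1') hy'
  rcases (hs.1.trans ht.1).eq_or_lt with h0 | h0
  · exact h0 ▸ hty
  · exact (hγ.chron (left_mem_Icc.2 zero_le_one) ⟨h0.le, ht.2⟩ h0).trans hty

theorem isOpen_setOf_chron_left (q : M) : IsOpen {p | 𝒮.Chron p q} := by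
  rw [isOpen_iff_mem_nhds]
  rintro p ⟨γ, hγ, rfl, rfl⟩
  obtain ⟨s, hs, hs0, harc⟩ := (hγ.2.2 0 (left_mem_Icc.2 zero_le_one)).1
    ⟨1, right_mem_Icc.2 zero_le_one, one_pos⟩
  obtain ⟨v, hv, hslope⟩ := harc.tendsto_slope hs0 (left_mem_Icc.2 hs0.le)
  obtain ⟨ε, hε, hchron⟩ := 𝒮.exists_ball_chron hv
  have hne : (𝓝[Icc 0 s \ {0}] (0 : ℝ)).NeBot := by
    rw [Icc_sdiff_left]; exact left_nhdsWithin_Ioc_neBot hs0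
  have hγc : Tendsto γ (𝓝[Icc 0 s \ {0}] 0) (𝓝 (γ 0)) :=
    (harc.1.continuousOn 0 (left_mem_Icc.2 hs0.le)).mono_left (nhdsWithin_mono _ sdiff_subset)
  obtain ⟨t, ⟨⟨ht, ht0⟩, hsl⟩, htb⟩ := ((eventually_mem_nhdsWithin.and
    (hslope.eventually (Metric.ball_mem_nhds v hε))).and
    (hγc.eventually (eventually_chart_mem_ball (n := n) _ hε))).exists
  have ht0' : 0 < t := lt_of_le_of_ne ht.1 (Ne.symm ht0)
  set φ := extChartAt (𝓡 n) (γ 0) with hφ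
  have hcont : ContinuousAt (fun y => t⁻¹ • (φ (γ t) - φ y)) (γ 0) :=
    ContinuousAt.const_smul (g := fun y => φ (γ t) - φ y)
      (continuousAt_const.sub (continuousAt_extChartAt (γ 0))) t⁻¹
  have hmem : t⁻¹ • (φ (γ t) - φ (γ 0)) ∈ Metric.ball v ε := by
    simpa [slope_def_module] using hsl
  filter_upwards [eventually_chart_mem_ball (n := n) (γ 0) hε,
    hcont.preimage_mem_nhds (Metric.isOpen_ball.mem_nhds hmem)] with y hy hy'
  have hty : 𝒮.Chron y (γ t) := hchron _ hy.1 _ htb.1 hy.2 htb.2 t ht0' hy'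
  rcases (ht.2.trans hs.2).eq_or_lt with h0 | h0
  · exact h0 ▸ hty
  · exact hty.trans (hγ.chron ⟨ht.1, h0.le⟩ (right_mem_Icc.2 zero_le_one) h0)

variable (𝒮)

/-- A short chart segment issuing from `q` in a future direction is timelike. -/
theorem exists_chron_right (q : M) : ∃ y, 𝒮.Chron q y := by
  obtain ⟨v, hv⟩ : ∃ v : EuclideanSpace ℝ (Fin n),
      v ∈ (𝒮.future q : Set (EuclideanSpace ℝ (Fin n))) := 𝒮.future_nonempty q
  obtain ⟨ε, hε, h⟩ := 𝒮.exists_ball_chron (q := q) (v := v) hv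
  set φ := extChartAt (𝓡 n) q with hφ
  have hl : Tendsto (fun τ : ℝ => φ q + τ • v) (𝓝[>] 0) (𝓝 (φ q)) := by
    have : ContinuousAt (fun τ : ℝ => φ q + τ • v) 0 := by fun_prop
    have h2 := this.tendsto
    rw [zero_smul, add_zero] at h2
    exact h2.mono_left nhdsWithin_le_nhds
  obtain ⟨τ, hτ, hb, ht⟩ := (eventually_mem_nhdsWithin.and ((hl.eventually
    (Metric.ball_mem_nhds _ hε)).and (hl.eventually
      ((isOpen_extChartAt_target q).mem_nhds (mem_extChartAt_target q))))).exists
  have hτ0 : (0 : ℝ) < τ := hτ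
  have hr : φ (φ.symm (φ q + τ • v)) = φ q + τ • v := φ.right_inv ht
  refine ⟨φ.symm (φ q + τ • v), h _ (mem_extChartAt_source q) _ (φ.map_target ht)
    (Metric.mem_ball_self hε) (by rw [hr]; exact hb) τ hτ0 ?_⟩
  rw [hr, add_sub_cancel_left, smul_smul, inv_mul_cancel₀ hτ0.ne', one_smul]
  exact Metric.mem_ball_self hε

theorem exists_chron_left (q : M) : ∃ y, 𝒮.Chron y q := by
  obtain ⟨v, hv⟩ : ∃ v : EuclideanSpace ℝ (Fin n),
      v ∈ (𝒮.future q : Set (EuclideanSpace ℝ (Fin n))) := 𝒮.future_nonempty q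
  obtain ⟨ε, hε, h⟩ := 𝒮.exists_ball_chron (q := q) (v := v) hv
  set φ := extChartAt (𝓡 n) q with hφ
  have hl : Tendsto (fun τ : ℝ => φ q - τ • v) (𝓝[>] 0) (𝓝 (φ q)) := by
    have : ContinuousAt (fun τ : ℝ => φ q - τ • v) 0 := by fun_prop
    have h2 := this.tendsto
    rw [zero_smul, sub_zero] at h2
    exact h2.mono_left nhdsWithin_le_nhds
  obtain ⟨τ, hτ, hb, ht⟩ := (eventually_mem_nhdsWithin.and ((hl.eventually
    (Metric.ball_mem_nhds _ hε)).and (hl.eventually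
      ((isOpen_extChartAt_target q).mem_nhds (mem_extChartAt_target q))))).exists
  have hτ0 : (0 : ℝ) < τ := hτ
  have hr : φ (φ.symm (φ q - τ • v)) = φ q - τ • v := φ.right_inv ht
  refine ⟨φ.symm (φ q - τ • v), h _ (φ.map_target ht) _ (mem_extChartAt_source q)
    (by rw [hr]; exact hb) (Metric.mem_ball_self hε) τ hτ0 ?_⟩
  rw [hr, sub_sub_cancel, smul_smul, inv_mul_cancel₀ hτ0.ne', one_smul]
  exact Metric.mem_ball_self hε

end Local

end ConformalSpacetime

/-! ### Conformal embeddings in equal dimension and the lifting of timelike curves -/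

theorem Manifold.IsImmersionAtOfComplement.isLocalDiffeomorphAt {n : ℕ} {M N F : Type*}
    [TopologicalSpace M] [ChartedSpace (EuclideanSpace ℝ (Fin n)) M] [TopologicalSpace N]
    [ChartedSpace (EuclideanSpace ℝ (Fin n)) N] [NormedAddCommGroup F] [NormedSpace ℝ F]
    [IsManifold (𝓡 n) ∞ M] [IsManifold (𝓡 n) ∞ N]
    {f : M → N} {x : M} (h : IsImmersionAtOfComplement F (𝓡 n) (𝓡 n) ∞ f x) :
    IsLocalDiffeomorphAt (𝓡 n) (𝓡 n) ∞ f x := by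
  -- Counting dimensions forces the complement `F` to vanish; the immersion normal form `y ↦ (y, 0)`
  -- then becomes the linear isomorphism `A` below.
  have hfin : FiniteDimensional ℝ (EuclideanSpace ℝ (Fin n) × F) :=
    h.equiv.symm.toLinearEquiv.finiteDimensional
  have hF : FiniteDimensional ℝ F :=
    FiniteDimensional.of_surjective (LinearMap.snd ℝ (EuclideanSpace ℝ (Fin n)) F)
      LinearMap.snd_surjective
  have hrank := h.equiv.toLinearEquiv.finrank_eq
  rw [Module.finrank_prod] at hrank
  have hsub : Subsingleton F := Module.finrank_zero_iff.1 (by omega : Module.finrank ℝ F = 0)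
  have huniq : Unique F := ⟨⟨0⟩, fun _ => Subsingleton.elim _ _⟩
  set A : EuclideanSpace ℝ (Fin n) ≃L[ℝ] EuclideanSpace ℝ (Fin n) :=
    (ContinuousLinearEquiv.prodUnique ℝ (EuclideanSpace ℝ (Fin n)) F).symm.trans h.equiv with hA
  have hAe : ∀ y, A y = h.equiv (y, 0) := fun y => by
    simp only [hA, ContinuousLinearEquiv.trans_apply]
    congr 1
    exact Prod.ext rfl (Subsingleton.elim _ _)
  have hw : ∀ y ∈ h.domChart.source, h.codChart (f y) = A (h.domChart y) := by
    intro y hy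
    have h1 : h.domChart y ∈ (h.domChart.extend (𝓡 n)).target := by
      simpa using h.domChart.map_source hy
    have h2 := h.writtenInCharts h1
    simp only [Function.comp, OpenPartialHomeomorph.extend, PartialEquiv.coe_trans,
      PartialEquiv.coe_trans_symm] at h2
    rw [hAe]
    simpa [h.domChart.left_inv hy] using h2
  set e : OpenPartialHomeomorph M N :=
    (h.domChart.trans A.toHomeomorph.toOpenPartialHomeomorph).trans h.codChart.symm with he
  have hsrc : e.source = h.domChart.source := by
    ext y
    simp only [he, OpenPartialHomeomorph.trans_source, mem_inter_iff, mem_preimage]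
    constructor
    · intro hy; exact hy.1.1
    · intro hy
      refine ⟨⟨hy, mem_univ _⟩, ?_⟩
      have := h.codChart.map_source (h.source_subset_preimage_source hy)
      rw [hw y hy] at this
      exact this
  have hef : EqOn f e e.source := by
    intro y hy
    rw [hsrc] at hy
    have : e y = h.codChart.symm (A (h.domChart y)) := rfl
    rw [this, ← hw y hy, h.codChart.left_inv (h.source_subset_preimage_source hy)]
  have hAsm : ContMDiff (𝓡 n) (𝓡 n) ∞ A := by
    rw [contMDiff_iff_contDiff]; exact A.contDiff
  have hAsm' : ContMDiff (𝓡 n) (𝓡 n) ∞ A.symm := by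
    rw [contMDiff_iff_contDiff]; exact A.symm.contDiff
  have hd := h.domChart_mem_maximalAtlas
  have hc := h.codChart_mem_maximalAtlas
  refine ⟨⟨e.toPartialEquiv, e.open_source, e.open_target, ?_, ?_⟩, ?_, hef⟩
  · refine (contMDiffOn_symm_of_mem_maximalAtlas hc).comp ((hAsm.comp_contMDiffOn
      (contMDiffOn_of_mem_maximalAtlas hd)).mono ?_) ?_
    · exact fun y hy => hy.1.1
    · exact fun y hy => hy.2
  · refine (contMDiffOn_symm_of_mem_maximalAtlas hd).comp ((hAsm'.comp_contMDiffOn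
      (contMDiffOn_of_mem_maximalAtlas hc)).mono ?_) ?_
    · exact fun y hy => hy.1
    · exact fun y hy => hy.2.2
  · change x ∈ e.source
    rw [hsrc]
    exact h.mem_domChart_source

theorem Manifold.IsSmoothEmbedding.isLocalDiffeomorph {n : ℕ} {M N : Type*}
    [TopologicalSpace M] [ChartedSpace (EuclideanSpace ℝ (Fin n)) M] [TopologicalSpace N]
    [ChartedSpace (EuclideanSpace ℝ (Fin n)) N]
    [IsManifold (𝓡 n) ∞ M] [IsManifold (𝓡 n) ∞ N]
    {f : M → N} (h : IsSmoothEmbedding (𝓡 n) (𝓡 n) ∞ f) :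
    IsLocalDiffeomorph (𝓡 n) (𝓡 n) ∞ f := by
  obtain ⟨F, _, _, hF⟩ := h.isImmersion
  exact fun x => (hF x).isLocalDiffeomorphAt

namespace ConformalSpacetime.IsConformalEmbedding

variable {n : ℕ} {M : Type*} [TopologicalSpace M]
  [ChartedSpace (EuclideanSpace ℝ (Fin n)) M] [IsManifold (𝓡 n) ∞ M]
  {N : Type*} [TopologicalSpace N]
  [ChartedSpace (EuclideanSpace ℝ (Fin n)) N] [IsManifold (𝓡 n) ∞ N]
  {𝒮 : ConformalSpacetime n M} {𝒯 : ConformalSpacetime n N} {f : M → N}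

theorem mfderiv_mem_timelikeCone_iff (hf : 𝒮.IsConformalEmbedding 𝒯 f) {x : M}
    {v : TangentSpace (𝓡 n) x} :
    mfderiv (𝓡 n) (𝓡 n) f x v ∈ 𝒯.conformalClass.timelikeCone (f x) ↔
      v ∈ 𝒮.conformalClass.timelikeCone x := by
  obtain ⟨g, h, hg, hh, φ, -, hφ⟩ := hf.conformal
  rw [mem_timelikeCone_iff hg, mem_timelikeCone_iff hh, hφ]
  exact ⟨fun h => (pos_iff_neg_of_mul_neg h).1 (Real.exp_pos _),
    fun h => mul_neg_of_pos_of_neg (Real.exp_pos _) h⟩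

theorem isOpen_range (hf : 𝒮.IsConformalEmbedding 𝒯 f) : IsOpen (range f) :=
  hf.isSmoothEmbedding.isLocalDiffeomorph.isOpen_range

theorem injective (hf : 𝒮.IsConformalEmbedding 𝒯 f) : Function.Injective f :=
  hf.isSmoothEmbedding.isEmbedding.injective

theorem continuous (hf : 𝒮.IsConformalEmbedding 𝒯 f) : Continuous f :=
  hf.isSmoothEmbedding.isEmbedding.continuous

/-- `map_future` gives only one inclusion of cones. The derivative is a linear homeomorphism
carrying timelike cone onto timelike cone, so it carries components onto components, and one vector
decides which. -/
theorem exists_mfderiv_eq (hf : 𝒮.IsConformalEmbedding 𝒯 f) {x : M}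
    {w : TangentSpace (𝓡 n) (f x)} (hw : w ∈ 𝒯.future (f x)) :
    ∃ v ∈ 𝒮.future x, mfderiv (𝓡 n) (𝓡 n) f x v = w := by
  let L : TangentSpace (𝓡 n) x ≃L[ℝ] TangentSpace (𝓡 n) (f x) :=
    hf.isSmoothEmbedding.isLocalDiffeomorph.mfderivToContinuousLinearEquiv (by simp) x
  have hL : ∀ v, L v = mfderiv (𝓡 n) (𝓡 n) f x v := fun v => rfl
  obtain ⟨v₀, hv₀⟩ := 𝒮.future_nonempty x
  have hLv₀ : L v₀ ∈ 𝒯.future (f x) := hf.map_future x v₀ hv₀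
  have himg : L.toHomeomorph '' (𝒮.conformalClass.timelikeCone x) =
      𝒯.conformalClass.timelikeCone (f x) := by
    ext u
    constructor
    · rintro ⟨v, hv, rfl⟩
      exact hf.mfderiv_mem_timelikeCone_iff.2 hv
    · intro hu
      refine ⟨L.symm u, hf.mfderiv_mem_timelikeCone_iff.1 ?_, L.apply_symm_apply u⟩
      rw [← hL, L.apply_symm_apply]
      exact hu
  rw [𝒯.future_eq_component hLv₀, ← himg] at hw
  have h1 := L.toHomeomorph.image_connectedComponentIn
    (𝒮.future_subset_timelikeCone x hv₀)
  have h2 : w ∈ L.toHomeomorph '' connectedComponentIn (𝒮.conformalClass.timelikeCone x) v₀ := by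
    rw [h1]; exact hw
  rw [← 𝒮.future_eq_component hv₀] at h2
  exact h2

theorem isTimelikeCurve_comp (hf : 𝒮.IsConformalEmbedding 𝒯 f) {γ : ℝ → M} {J : Set ℝ}
    (h : 𝒮.IsTimelikeCurve γ J) : 𝒯.IsTimelikeCurve (f ∘ γ) J :=
  IsCurve.map h (fun _ _ => (hf.isSmoothEmbedding.isLocalDiffeomorph.contMDiff _).of_le (by simp))
    (fun _ _ v hv => hf.map_future _ v hv)

theorem exists_lift (hf : 𝒮.IsConformalEmbedding 𝒯 f) {γ : ℝ → N} {J : Set ℝ}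
    (h : 𝒯.IsTimelikeCurve γ J) (hJ : ∀ t ∈ J, γ t ∈ range f) :
    ∃ δ : ℝ → M, 𝒮.IsTimelikeCurve δ J ∧ ∀ t ∈ J, f (δ t) = γ t := by
  obtain ⟨t₀, ht₀⟩ := h.1
  obtain ⟨x₀, -⟩ := hJ t₀ ht₀
  have : Nonempty M := ⟨x₀⟩
  -- The values of `g` off the range are arbitrary. Near each point of the range, `g` agrees with a
  -- local inverse of `f` and is therefore smooth there.
  set g : N → M := Function.invFun f with hg
  have hgf : ∀ x, g (f x) = x := Function.leftInverse_invFun hf.injective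
  have hsm : ∀ x, ContMDiffAt (𝓡 n) (𝓡 n) ∞ g (f x) := by
    intro x
    have hx := hf.isSmoothEmbedding.isLocalDiffeomorph x
    refine hx.localInverse_contMDiffAt.congr_of_eventuallyEq ?_
    filter_upwards [hx.localInverse_open_source.mem_nhds hx.localInverse_mem_source] with y hy
    conv_lhs => rw [← hx.localInverse_right_inv hy]
    exact hgf _
  have hmf : ∀ x, ∀ w ∈ 𝒯.future (f x), mfderiv (𝓡 n) (𝓡 n) g (f x) w ∈ 𝒮.future (g (f x)) := by
    intro x w hw
    obtain ⟨v, hv, rfl⟩ := hf.exists_mfderiv_eq hw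
    have h1 := mfderiv_comp x ((hsm x).mdifferentiableAt (by simp))
      ((hf.isSmoothEmbedding.isLocalDiffeomorph.contMDiff x).mdifferentiableAt (by simp))
    have h2 : g ∘ f = id := funext hgf
    rw [h2, mfderiv_id] at h1
    have h3 : mfderiv (𝓡 n) (𝓡 n) g (f x) (mfderiv (𝓡 n) (𝓡 n) f x v) = v :=
      (congrArg (fun F : EuclideanSpace ℝ (Fin n) →L[ℝ] EuclideanSpace ℝ (Fin n) => F v) h1).symm
    exact mem_cone_of_eq (K := 𝒮.future) (hgf x).symm (Set.mem_of_eq_of_mem h3 hv)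
  refine ⟨g ∘ γ, IsCurve.map h (fun t ht => ?_) (fun t ht => ?_), fun t ht => ?_⟩
  · obtain ⟨x, hx⟩ := hJ t ht
    exact hx ▸ (hsm x).of_le (by simp)
  · obtain ⟨x, hx⟩ := hJ t ht
    exact hx ▸ hmf x
  · exact Function.invFun_eq (hJ t ht)

end ConformalSpacetime.IsConformalEmbedding

/-! ### Extending timelike curves to inextensible ones -/

/-- In a second countable space, a transitive relation with open lower sets which separates every
point from some larger point admits chains without limit. -/
theorem exists_chain_not_tendsto {X : Type*} [TopologicalSpace X] [SecondCountableTopology X]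
    {R : X → X → Prop} (htrans : ∀ x y z, R x y → R y z → R x z) (hex : ∀ x, ∃ y, R x y)
    (hopen : ∀ y, IsOpen {x | R x y}) (hsep : ∀ q, ∃ y, R q y ∧ ∀ᶠ b in 𝓝 q, ¬ R y b) (x₀ : X) :
    ∃ x : ℕ → X, x 0 = x₀ ∧ (∀ k, R (x k) (x (k + 1))) ∧ ¬ ∃ q, Tendsto x atTop (𝓝 q) := by
  obtain ⟨B, hBc, -, hB⟩ := TopologicalSpace.exists_countable_basis X
  obtain ⟨b₀, hb₀⟩ : B.Nonempty := by
    obtain ⟨s, hs, -⟩ := hB.mem_nhds_iff.1 (univ_mem (f := 𝓝 x₀))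
    exact ⟨s, hs⟩
  obtain ⟨e, he⟩ := hBc.exists_eq_range ⟨b₀, hb₀⟩
  -- Greedy choice: whenever some successor of `x` has no successor in the basic set `e k`, take
  -- such a one.
  have hstep : ∀ k x, ∃ y, R x y ∧
      ((∃ z, R x z ∧ ∀ b ∈ e k, ¬ R z b) → ∀ b ∈ e k, ¬ R y b) := by
    intro k x
    by_cases h : ∃ z, R x z ∧ ∀ b ∈ e k, ¬ R z b
    · obtain ⟨z, hz, hzb⟩ := h
      exact ⟨z, hz, fun _ => hzb⟩
    · obtain ⟨y, hy⟩ := hex x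
      exact ⟨y, hy, fun h' => absurd h' h⟩
  choose next hnext hsepn using hstep
  set x : ℕ → X := fun k => Nat.rec x₀ (fun k x => next k x) k with hx
  have hR : ∀ k, R (x k) (x (k + 1)) := fun k => hnext k (x k)
  have hlt : ∀ i j, i < j → R (x i) (x j) := by
    intro i j hij
    induction j, hij using Nat.le_induction with
    | base => exact hR i
    | succ j _ ih => exact htrans _ _ _ ih (hR j)
  refine ⟨x, rfl, hR, ?_⟩
  rintro ⟨q, hq⟩
  obtain ⟨y, hqy, hyb⟩ := hsep q
  obtain ⟨s, hsB, hqs, hs⟩ := hB.mem_nhds_iff.1 hyb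
  obtain ⟨k, rfl⟩ : s ∈ range e := he ▸ hsB
  -- A limit `q` puts late terms below `y`. So `y` was an admissible choice at stage `k`, and no
  -- successor of `x (k + 1)` lies in the neighbourhood `e k` of `q`, although the chain must enter
  -- it.
  obtain ⟨m, hm, hm'⟩ := ((hq.eventually ((hopen y).mem_nhds hqy)).and
    (eventually_gt_atTop k)).exists
  have hky : R (x k) y := htrans _ _ _ (hlt k m hm') hm
  have hno := hsepn k (x k) ⟨y, hky, fun b hb => hs hb⟩
  obtain ⟨m, hm, hm'⟩ := ((hq.eventually ((hB.isOpen hsB).mem_nhds hqs)).and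
    (eventually_gt_atTop (k + 1))).exists
  exact hno _ hm (hlt (k + 1) m hm')

namespace ConformalSpacetime

variable {n : ℕ} {M : Type*} [TopologicalSpace M]
  [ChartedSpace (EuclideanSpace ℝ (Fin n)) M] [IsManifold (𝓡 n) ∞ M]
  {𝒮 : ConformalSpacetime n M}

/-- By antisymmetry a closed timelike curve would be constant, but then its velocity is zero, which
is not timelike. -/
theorem IsStronglyCausal.not_chron_self [T1Space M] (hS : 𝒮.IsStronglyCausal) (p : M) :
    ¬ 𝒮.Chron p p := by
  rintro ⟨γ, hγ, h0, h1⟩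
  have hconst : EqOn (fun _ => p) γ (Icc 0 1) := by
    intro t ht
    rcases ht.1.eq_or_lt with rfl | ht0
    · exact h0.symm
    rcases ht.2.eq_or_lt with rfl | ht1
    · exact h1.symm
    have h2 := hγ.chron (left_mem_Icc.2 zero_le_one) ht ht0
    have h3 := hγ.chron ht (right_mem_Icc.2 zero_le_one) ht1
    rw [h0] at h2
    rw [h1] at h3
    exact hS.antisymm h2.mem_causalFutureOf h3.mem_causalFutureOf
  obtain ⟨s, hs, hs0, harc⟩ := (hγ.2.2 0 (left_mem_Icc.2 zero_le_one)).1
    ⟨1, right_mem_Icc.2 zero_le_one, one_pos⟩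
  have h2 := (harc.congr (hconst.mono (Icc_subset_Icc_right hs.2))).2 0 (left_mem_Icc.2 hs0.le)
  rw [mfderivWithin_const] at h2
  obtain ⟨g, -, h⟩ := 𝒮.future_subset_timelikeCone _ h2
  have h3 : g.form p 0 0 < 0 := h
  simp at h3

/-- Choose `w ≫ q`. Points above `y` accumulating at `q` would lie in the closed diamond between `y`
and `w`, giving `y ≤ q`, hence `q = y` and `q ≪ q`. This is the separation needed by
`exists_chain_not_tendsto`. -/
theorem IsGloballyHyperbolic.eventually_not_chron_right [T2Space M]
    (hM : 𝒮.IsGloballyHyperbolic) {q y : M} (hqy : 𝒮.Chron q y) :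
    ∀ᶠ b in 𝓝 q, ¬ 𝒮.Chron y b := by
  obtain ⟨w, hw⟩ := 𝒮.exists_chron_right q
  by_contra hcon
  have hfreq : ∃ᶠ b in 𝓝 q, b ∈ 𝒮.causalPastOf w ∩ 𝒮.causalFutureOf y := by
    refine (Filter.not_eventually.1 hcon).mp ?_
    filter_upwards [(isOpen_setOf_chron_left w).mem_nhds hw] with b hb hyb
    exact ⟨Chron.mem_causalFutureOf hb, (not_not.1 hyb).mem_causalFutureOf⟩
  have hq := (hM.2 w y).isClosed.mem_of_frequently_of_tendsto hfreq tendsto_id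
  have heq : q = y := hM.1.antisymm hqy.mem_causalFutureOf hq.2
  exact hM.1.not_chron_self q (by rw [← heq] at hqy; exact hqy)

theorem IsGloballyHyperbolic.eventually_not_chron_left [T2Space M]
    (hM : 𝒮.IsGloballyHyperbolic) {q y : M} (hyq : 𝒮.Chron y q) :
    ∀ᶠ b in 𝓝 q, ¬ 𝒮.Chron b y := by
  obtain ⟨w, hw⟩ := 𝒮.exists_chron_left q
  by_contra hcon
  have hfreq : ∃ᶠ b in 𝓝 q, b ∈ 𝒮.causalPastOf y ∩ 𝒮.causalFutureOf w := by
    refine (Filter.not_eventually.1 hcon).mp ?_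
    filter_upwards [(isOpen_setOf_chron_right w).mem_nhds hw] with b hb hyb
    exact ⟨(not_not.1 hyb).mem_causalFutureOf, Chron.mem_causalFutureOf hb⟩
  have hq := (hM.2 y w).isClosed.mem_of_frequently_of_tendsto hfreq tendsto_id
  have heq : q = y := hM.1.antisymm hq.1 hyq.mem_causalFutureOf
  exact hM.1.not_chron_self q (by rw [← heq] at hyq; exact hyq)

/-- In a globally hyperbolic spacetime, timelike curves extend to complete timelike curves without
endpoints. -/
theorem IsGloballyHyperbolic.exists_inextensible [T2Space M] [SecondCountableTopology M]
    (hM : 𝒮.IsGloballyHyperbolic) {γ : ℝ → M} (hγ : 𝒮.IsTimelikeCurve γ (Icc 0 1)) :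
    ∃ Γ : ℝ → M, 𝒮.IsTimelikeCurve Γ univ ∧ EqOn Γ γ (Icc 0 1) ∧
      (¬ ∃ q, Tendsto Γ atTop (𝓝 q)) ∧ ¬ ∃ q, Tendsto Γ atBot (𝓝 q) := by
  obtain ⟨x, hx0, hx, hxlim⟩ := exists_chain_not_tendsto (R := 𝒮.Chron)
    (fun _ _ _ h h' => h.trans h') 𝒮.exists_chron_right isOpen_setOf_chron_left
    (fun q => (𝒮.exists_chron_right q).imp fun y hy => ⟨hy, hM.eventually_not_chron_right hy⟩) (γ 1)
  obtain ⟨z, hz0, hz, hzlim⟩ := exists_chain_not_tendsto (R := fun a b => 𝒮.Chron b a)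
    (fun _ _ _ h h' => h'.trans h) 𝒮.exists_chron_left isOpen_setOf_chron_right
    (fun q => (𝒮.exists_chron_left q).imp fun y hy => ⟨hy, hM.eventually_not_chron_left hy⟩) (γ 0)
  choose cx hcx hcx0 hcx1 using hx
  choose cz hcz hcz0 hcz1 using hz
  -- the points at the integers `k ≥ 1` are `x (k - 1)`, those at the integers `-k ≤ 0` are `z k`
  set c : ℤ → ℝ → M := fun k => match k with
    | .ofNat 0 => γ
    | .ofNat (k + 1) => cx k
    | .negSucc k => cz k with hc
  have hcurve : ∀ k, IsCurve 𝒮.future (c k) (Icc 0 1) := by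
    rintro ((_ | k) | k)
    · exact hγ
    · exact hcx k
    · exact hcz k
  have hjoin : ∀ k, c k 1 = c (k + 1) 0 := by
    rintro ((_ | k) | (_ | k))
    · exact hx0.symm.trans (hcx0 0).symm
    · exact (hcx1 k).trans (hcx0 (k + 1)).symm
    · exact (hcz1 0).trans hz0
    · exact (hcz1 (k + 1)).trans (hcz0 k).symm
  refine ⟨_, IsCurve.glue_int 𝒮.smul_mem_future hcurve hjoin, ?_, ?_, ?_⟩
  · rintro t ⟨h0, h1⟩
    rcases h1.eq_or_lt with rfl | h1
    · simp only [Int.floor_one, Int.fract_one]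
      exact (hcx0 0).trans hx0
    · have h2 : ⌊t⌋ = 0 := Int.floor_eq_zero_iff.2 ⟨h0, h1⟩
      have h3 : Int.fract t = t := Int.fract_eq_self.2 ⟨h0, h1⟩
      simp only [h2, h3]
      rfl
  · rintro ⟨q, hq⟩
    refine hxlim ⟨q, ?_⟩
    have h2 : Tendsto (fun k : ℕ => ((k : ℝ) + 1)) atTop atTop :=
      tendsto_atTop_add_const_right _ _ tendsto_natCast_atTop_atTop
    refine (hq.comp h2).congr fun k => ?_
    have h3 : ⌊(k : ℝ) + 1⌋ = Int.ofNat (k + 1) := by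
      rw [Int.floor_eq_iff, Int.ofNat_eq_natCast]; push_cast; constructor <;> linarith
    have h4 : Int.fract ((k : ℝ) + 1) = 0 := by simp
    simp only [Function.comp, h3, h4]
    exact hcx0 k
  · rintro ⟨q, hq⟩
    refine hzlim ⟨q, ?_⟩
    -- The segment indexed by `Int.negSucc k` starts at `z (k + 1)`, so the shifted sequence is the
    -- one read off along the curve.
    rw [← tendsto_add_atTop_iff_nat 1]
    have h2 : Tendsto (fun k : ℕ => (-((k : ℝ) + 1))) atTop atBot :=
      tendsto_neg_atTop_atBot.comp
        (tendsto_atTop_add_const_right _ _ tendsto_natCast_atTop_atTop)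
    refine (hq.comp h2).congr fun k => ?_
    have h3 : ⌊-((k : ℝ) + 1)⌋ = Int.negSucc k := by
      rw [Int.floor_eq_iff, Int.negSucc_eq]; push_cast; constructor <;> linarith
    have h4 : Int.fract (-((k : ℝ) + 1)) = 0 := by
      rw [Int.fract, h3, Int.negSucc_eq]; push_cast; ring
    simp only [Function.comp, h3, h4]
    exact hcz0 k

end ConformalSpacetime

/-! ### Chronological convexity of the image -/

namespace ConformalSpacetime

/-- If a continuous curve in `N`, restricted to a connected component `J` of the preimage of the
open set `U`, has a limit in `U` at the end of `J`, then this is the end of the curve. -/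
theorem tendsto_atTop_of_component {N : Type*} [TopologicalSpace N] [T2Space N] {Γ : ℝ → N}
    (hΓ : Continuous Γ) {U : Set N} (hU : IsOpen U) {t₀ : ℝ} (ht₀ : Γ t₀ ∈ U) {y : N} (hy : y ∈ U)
    (h : Tendsto (fun t : connectedComponentIn (Γ ⁻¹' U) t₀ => Γ t) atTop (𝓝 y)) :
    Tendsto Γ atTop (𝓝 y) := by
  set J := connectedComponentIn (Γ ⁻¹' U) t₀ with hJ
  have hpre : IsPreconnected J := isPreconnected_connectedComponentIn
  have hord : J.OrdConnected := hpre.ordConnected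
  have ht₀J : t₀ ∈ J := mem_connectedComponentIn ht₀
  have hJU : J ⊆ Γ ⁻¹' U := connectedComponentIn_subset _ _
  have hJo : IsOpen J := (hU.preimage hΓ).connectedComponentIn
  change Tendsto (Γ ∘ ((↑) : J → ℝ)) atTop (𝓝 y) at h
  by_cases hb : BddAbove J
  -- If `J` had a finite supremum, continuity would give `Γ (sSup J) = y ∈ U`, and adjoining this
  -- point would enlarge the connected component.
  · exfalso
    have hlub : IsLUB J (sSup J) := isLUB_csSup ⟨t₀, ht₀J⟩ hb
    have hnot : sSup J ∉ J := fun hmem => by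
      obtain ⟨u, hu, hu'⟩ := ((eventually_nhdsWithin_of_eventually_nhds
        (hJo.eventually_mem hmem)).and (eventually_mem_nhdsWithin (s := Ioi (sSup J)))).exists
      exact absurd (hlub.1 hu) (not_le.2 hu')
    have hJlt : J ⊆ Iio (sSup J) := fun u hu =>
      lt_of_le_of_ne (hlub.1 hu) (fun e => hnot (e ▸ hu))
    have hIoo : Ioo t₀ (sSup J) ⊆ J := by
      rintro u ⟨hu, hu'⟩
      obtain ⟨j, hj, huj⟩ := (lt_isLUB_iff hlub).1 hu'
      exact hord.out ht₀J hj ⟨hu.le, huj.le⟩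
    rw [← tendsto_map'_iff,
      map_coe_atTop_of_Ioo_subset hJlt (fun _ _ => ⟨t₀, hJlt ht₀J, hIoo⟩)] at h
    have hβ : Γ (sSup J) = y := tendsto_nhds_unique (hΓ.continuousAt.mono_left nhdsWithin_le_nhds) h
    have hins : IsPreconnected (insert (sSup J) J) := hpre.subset_closure (subset_insert _ _)
      (insert_subset (hlub.mem_closure ⟨t₀, ht₀J⟩) subset_closure)
    exact hnot (hins.subset_connectedComponentIn (mem_insert_of_mem _ ht₀J)
      (insert_subset (show Γ (sSup J) ∈ U from hβ ▸ hy) hJU) (mem_insert _ _))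
  -- Otherwise `J` contains a whole ray, and the end of `J` is the end of `ℝ`.
  · have hIci : Ici t₀ ⊆ J := fun u hu => by
      obtain ⟨j, hj, huj⟩ := not_bddAbove_iff.1 hb u
      exact hord.out ht₀J hj ⟨hu, huj.le⟩
    rwa [← tendsto_map'_iff, map_val_atTop_of_Ici_subset hIci] at h

/-- The time reversal of `tendsto_atTop_of_component`. -/
theorem tendsto_atBot_of_component {N : Type*} [TopologicalSpace N] [T2Space N] {Γ : ℝ → N}
    (hΓ : Continuous Γ) {U : Set N} (hU : IsOpen U) {t₀ : ℝ} (ht₀ : Γ t₀ ∈ U) {y : N} (hy : y ∈ U)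
    (h : Tendsto (fun t : connectedComponentIn (Γ ⁻¹' U) t₀ => Γ t) atBot (𝓝 y)) :
    Tendsto Γ atBot (𝓝 y) := by
  set J := connectedComponentIn (Γ ⁻¹' U) t₀ with hJ
  have hpre : IsPreconnected J := isPreconnected_connectedComponentIn
  have hord : J.OrdConnected := hpre.ordConnected
  have ht₀J : t₀ ∈ J := mem_connectedComponentIn ht₀
  have hJU : J ⊆ Γ ⁻¹' U := connectedComponentIn_subset _ _
  have hJo : IsOpen J := (hU.preimage hΓ).connectedComponentIn
  change Tendsto (Γ ∘ ((↑) : J → ℝ)) atBot (𝓝 y) at h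
  by_cases hb : BddBelow J
  · exfalso
    have hglb : IsGLB J (sInf J) := isGLB_csInf ⟨t₀, ht₀J⟩ hb
    have hnot : sInf J ∉ J := fun hmem => by
      obtain ⟨u, hu, hu'⟩ := ((eventually_nhdsWithin_of_eventually_nhds
        (hJo.eventually_mem hmem)).and (eventually_mem_nhdsWithin (s := Iio (sInf J)))).exists
      exact absurd (hglb.1 hu) (not_le.2 hu')
    have hJlt : J ⊆ Ioi (sInf J) := fun u hu =>
      lt_of_le_of_ne (hglb.1 hu) (fun e => hnot (e ▸ hu))
    have hIoo : Ioo (sInf J) t₀ ⊆ J := by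
      rintro u ⟨hu, hu'⟩
      obtain ⟨j, hj, huj⟩ := (isGLB_lt_iff hglb).1 hu
      exact hord.out hj ht₀J ⟨huj.le, hu'.le⟩
    rw [← tendsto_map'_iff,
      map_coe_atBot_of_Ioo_subset hJlt (fun _ _ => ⟨t₀, hJlt ht₀J, hIoo⟩)] at h
    have hβ : Γ (sInf J) = y := tendsto_nhds_unique (hΓ.continuousAt.mono_left nhdsWithin_le_nhds) h
    have hins : IsPreconnected (insert (sInf J) J) := hpre.subset_closure (subset_insert _ _)
      (insert_subset (hglb.mem_closure ⟨t₀, ht₀J⟩) subset_closure)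
    exact hnot (hins.subset_connectedComponentIn (mem_insert_of_mem _ ht₀J)
      (insert_subset (show Γ (sInf J) ∈ U from hβ ▸ hy) hJU) (mem_insert _ _))
  · have hIci : Iic t₀ ⊆ J := fun u hu => by
      obtain ⟨j, hj, huj⟩ := not_bddBelow_iff.1 hb u
      exact hord.out hj ht₀J ⟨huj.le, hu⟩
    rwa [← tendsto_map'_iff, map_val_atBot_of_Iic_subset hIci] at h

variable {n : ℕ} {M : Type*} [TopologicalSpace M]
  [ChartedSpace (EuclideanSpace ℝ (Fin n)) M] [IsManifold (𝓡 n) ∞ M]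
  {N : Type*} [TopologicalSpace N] [T2Space N]
  [ChartedSpace (EuclideanSpace ℝ (Fin n)) N] [IsManifold (𝓡 n) ∞ N]
  {𝒮 : ConformalSpacetime n M} {𝒯 : ConformalSpacetime n N} {f : M → N}

/-- Every component in `f(M)` of an inextensible timelike curve of `N` meets the image of every
Cauchy hypersurface of `M`. -/
theorem IsConformalEmbedding.exists_mem_image_cauchy (hf : 𝒮.IsConformalEmbedding 𝒯 f)
    {S : Set M} (hS : 𝒮.IsCauchyHypersurface S) {Γ : ℝ → N} (hΓ : 𝒯.IsTimelikeCurve Γ univ)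
    (htop : ¬ ∃ q, Tendsto Γ atTop (𝓝 q)) (hbot : ¬ ∃ q, Tendsto Γ atBot (𝓝 q)) {t₀ : ℝ}
    (ht₀ : Γ t₀ ∈ range f) :
    ∃ t ∈ connectedComponentIn (Γ ⁻¹' range f) t₀, Γ t ∈ f '' S := by
  set J := connectedComponentIn (Γ ⁻¹' range f) t₀ with hJ
  have hΓc : Continuous Γ := continuousOn_univ.1 (IsCurve.continuousOn hΓ)
  have hJU : ∀ t ∈ J, Γ t ∈ range f := fun t ht =>
    connectedComponentIn_subset (Γ ⁻¹' range f) t₀ ht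
  have hΓJ : 𝒯.IsTimelikeCurve Γ J := IsCurve.restrict hΓ (subset_univ _)
    ⟨t₀, mem_connectedComponentIn ht₀⟩ isPreconnected_connectedComponentIn.ordConnected
  obtain ⟨δ, hδ, hfδ⟩ := hf.exists_lift hΓJ hJU
  have hlim : ∀ {l : Filter J} {q : M}, Tendsto (fun t : J => δ t) l (𝓝 q) →
      Tendsto (fun t : J => Γ t) l (𝓝 (f q)) := fun {l q} hq =>
    ((hf.continuous.tendsto q).comp hq).congr (fun t => hfδ t t.2)
  -- An endpoint of the lift `δ` in `M` would map to a limit of `Γ` along `J` inside `f(M)`, and so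
  -- to an endpoint of `Γ` itself; thus `δ` is inextensible.
  obtain ⟨t, ⟨ht, htS⟩, -⟩ := hS.2 δ J hδ.isCausalCurve
    (fun ⟨q, hq⟩ => htop ⟨f q, tendsto_atTop_of_component hΓc hf.isOpen_range ht₀ ⟨q, rfl⟩
      (hlim hq)⟩)
    (fun ⟨q, hq⟩ => hbot ⟨f q, tendsto_atBot_of_component hΓc hf.isOpen_range ht₀ ⟨q, rfl⟩
      (hlim hq)⟩)
  exact ⟨t, ht, δ t, htS, hfδ t ht⟩

/-- The image of a Cauchy embedding is convex with respect to timelike curves. -/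
theorem IsConformalCauchyEmbedding.mem_range [SecondCountableTopology N]
    (hf : 𝒮.IsConformalCauchyEmbedding 𝒯 f) (hN : 𝒯.IsGloballyHyperbolic) {S : Set M}
    (hS : 𝒮.IsCauchyHypersurface S) {x y z : N} (hx : x ∈ range f) (hz : z ∈ range f)
    (hxy : 𝒯.Chron x y) (hyz : 𝒯.Chron y z) : y ∈ range f := by
  obtain ⟨γ, a, b, c, hab, hbc, hγ, rfl, rfl, rfl⟩ : ∃ (γ : ℝ → N) (a b c : ℝ), a ≤ b ∧ b ≤ c ∧
      IsCurve 𝒯.future γ (Icc a c) ∧ γ a = x ∧ γ b = y ∧ γ c = z := by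
    obtain ⟨γ, hγ, rfl, rfl⟩ := hxy
    obtain ⟨γ', hγ', h0, rfl⟩ := hyz
    obtain ⟨δ, hδ, h1, h2, h3⟩ := IsCurve.exists_concat 𝒯.smul_mem_future hγ hγ' zero_le_one
      zero_le_one h0.symm
    exact ⟨δ, 0, 1, _, zero_le_one, by norm_num, hδ, h1, h2, h3⟩
  rcases hab.eq_or_lt with rfl | hab'
  · exact hx
  have hac : 0 < c - a := by linarith
  have hγ' : 𝒯.IsTimelikeCurve (fun t => γ ((c - a) * t + a)) (Icc 0 1) := by
    refine hγ.comp_affine 𝒯.smul_mem_future hac ?_ ordConnected_Icc (nonempty_Icc.2 zero_le_one)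
    rintro t ⟨h1, h2⟩
    constructor <;> simp only <;> nlinarith
  obtain ⟨Γ, hΓ, hΓγ, htop, hbot⟩ := hN.exists_inextensible hγ'
  have h0 : Γ 0 = γ a := by rw [hΓγ (left_mem_Icc.2 zero_le_one)]; simp
  have h1 : Γ 1 = γ c := by rw [hΓγ (right_mem_Icc.2 zero_le_one)]; simp
  have hs : (b - a) / (c - a) ∈ Icc (0 : ℝ) 1 :=
    ⟨div_nonneg (by linarith) hac.le, by rw [div_le_one hac]; linarith⟩
  have hb : Γ ((b - a) / (c - a)) = γ b := by
    rw [hΓγ hs]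
    simp only
    rw [mul_div_cancel₀ _ hac.ne']
    congr 1; ring
  have hU0 : Γ 0 ∈ range f := h0 ▸ hx
  have hU1 : Γ 1 ∈ range f := h1 ▸ hz
  obtain ⟨t, ht, htS⟩ := hf.exists_mem_image_cauchy hS hΓ htop hbot hU0
  obtain ⟨t', ht', htS'⟩ := hf.exists_mem_image_cauchy hS hΓ htop hbot hU1
  -- The Cauchy property of `f(S)` in `N` enters here: both meeting times are equal, so the two
  -- components share a point.
  obtain ⟨u, -, hu⟩ := (hf.map_cauchy S hS).2 Γ univ hΓ.isCausalCurve
    (fun ⟨q, hq⟩ => htop ⟨q, by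
      rwa [← map_val_atTop_of_Ici_subset (subset_univ (Ici (0 : ℝ))), tendsto_map'_iff]⟩)
    (fun ⟨q, hq⟩ => hbot ⟨q, by
      rwa [← map_val_atBot_of_Iic_subset (subset_univ (Iic (0 : ℝ))), tendsto_map'_iff]⟩)
  have htt' : t = t' := (hu t ⟨mem_univ _, htS⟩).trans (hu t' ⟨mem_univ _, htS'⟩).symm
  subst htt'
  have hcomp : connectedComponentIn (Γ ⁻¹' range f) 0 = connectedComponentIn (Γ ⁻¹' range f) 1 :=
    (connectedComponentIn_eq ht).trans (connectedComponentIn_eq ht').symm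
  have h1mem : (1 : ℝ) ∈ connectedComponentIn (Γ ⁻¹' range f) 0 :=
    hcomp ▸ mem_connectedComponentIn hU1
  have hsmem := isPreconnected_connectedComponentIn.ordConnected.out
    (mem_connectedComponentIn (show (0 : ℝ) ∈ Γ ⁻¹' range f from hU0)) h1mem hs
  rw [← hb]
  exact connectedComponentIn_subset (Γ ⁻¹' range f) 0 hsmem

end ConformalSpacetime

/-! ### Boundary points, their terminal sets, and injectivity -/

namespace ConformalSpacetime

variable {n : ℕ} {M : Type*} [TopologicalSpace M]
  [ChartedSpace (EuclideanSpace ℝ (Fin n)) M] [IsManifold (𝓡 n) ∞ M]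
  {N : Type*} [TopologicalSpace N]
  [ChartedSpace (EuclideanSpace ℝ (Fin n)) N] [IsManifold (𝓡 n) ∞ N]
  {𝒮 : ConformalSpacetime n M} {𝒯 : ConformalSpacetime n N} {f : M → N}

theorem IsConformalEmbedding.chron_map (hf : 𝒮.IsConformalEmbedding 𝒯 f) {x y : M}
    (h : 𝒮.Chron x y) : 𝒯.Chron (f x) (f y) := by
  obtain ⟨γ, hγ, rfl, rfl⟩ := h
  exact ⟨f ∘ γ, hf.isTimelikeCurve_comp hγ, rfl, rfl⟩

theorem mem_preimage_chronPast_iff {X : Type*} {f : X → N} {p : N} {x : X} :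
    x ∈ f ⁻¹' (𝒯.chronPast {p} ∩ range f) ↔ 𝒯.Chron (f x) p := by
  rw [mem_preimage, mem_inter_iff, and_iff_left (mem_range_self x), mem_chronPast_iff]
  simp

/-- Every point in the chronological past of the end of a curve is in the chronological past of an
earlier point of the curve. -/
theorem IsTimelikeCurve.exists_chron_of_chron_end {γ : ℝ → N} (hγ : 𝒯.IsTimelikeCurve γ (Icc 0 1))
    {x : N} (hx : 𝒯.Chron x (γ 1)) : ∃ t ∈ Ico (0 : ℝ) 1, 𝒯.Chron x (γ t) := by
  have hc : Tendsto γ (𝓝[Ico 0 1] 1) (𝓝 (γ 1)) :=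
    (IsCurve.continuousOn hγ 1 (right_mem_Icc.2 zero_le_one)).mono_left
      (nhdsWithin_mono _ Ico_subset_Icc_self)
  have hne : (𝓝[Ico 0 1] (1 : ℝ)).NeBot := right_nhdsWithin_Ico_neBot one_pos
  exact (eventually_mem_nhdsWithin.and
    (hc.eventually ((isOpen_setOf_chron_right x).mem_nhds hx))).exists

variable [T2Space N] [SecondCountableTopology N]

/-- By `mem_range`, a timelike curve of `N` between two points of the image never leaves it, so it
lifts to `M`. -/
theorem IsConformalCauchyEmbedding.chron_of_map (hf : 𝒮.IsConformalCauchyEmbedding 𝒯 f)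
    (hN : 𝒯.IsGloballyHyperbolic) {S : Set M} (hS : 𝒮.IsCauchyHypersurface S) {x y : M}
    (h : 𝒯.Chron (f x) (f y)) : 𝒮.Chron x y := by
  obtain ⟨γ, hγ, h0, h1⟩ := h
  have hrange : ∀ t ∈ Icc (0 : ℝ) 1, γ t ∈ range f := by
    intro t ht
    rcases ht.1.eq_or_lt with rfl | ht0
    · exact ⟨x, h0.symm⟩
    rcases ht.2.eq_or_lt with rfl | ht1
    · exact ⟨y, h1.symm⟩
    exact hf.mem_range hN hS ⟨x, h0.symm⟩ ⟨y, h1.symm⟩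
      (hγ.chron (left_mem_Icc.2 zero_le_one) ht ht0)
      (hγ.chron ht (right_mem_Icc.2 zero_le_one) ht1)
  obtain ⟨δ, hδ, hfδ⟩ := hf.exists_lift hγ hrange
  refine ⟨δ, hδ, hf.injective ?_, hf.injective ?_⟩
  · rw [hfδ 0 (left_mem_Icc.2 zero_le_one), h0]
  · rw [hfδ 1 (right_mem_Icc.2 zero_le_one), h1]

/-- A point of the future boundary is the endpoint of a timelike curve running in `f(M)`. -/
theorem IsConformalCauchyEmbedding.exists_curve_to_boundary
    (hf : 𝒮.IsConformalCauchyEmbedding 𝒯 f) (hN : 𝒯.IsGloballyHyperbolic) {p : N}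
    (hp : p ∈ 𝒮.futureBoundary 𝒯 f) :
    ∃ S, 𝒮.IsCauchyHypersurface S ∧ p ∉ range f ∧ ∃ γ : ℝ → N,
      𝒯.IsTimelikeCurve γ (Icc 0 1) ∧ γ 1 = p ∧ ∀ t ∈ Ico (0 : ℝ) 1, γ t ∈ range f := by
  obtain ⟨hpf, S, hS, hpS⟩ := hp
  obtain ⟨_, ⟨x, -, rfl⟩, γ, hγ, h0, rfl⟩ := mem_chronFuture_iff.1 hpS
  rw [hf.isOpen_range.frontier_eq] at hpf
  refine ⟨S, hS, hpf.2, γ, hγ, rfl, fun t ht => ?_⟩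
  rcases ht.1.eq_or_lt with rfl | ht0
  · exact ⟨x, h0.symm⟩
  have hchron := hγ.chron ⟨ht.1, ht.2.le⟩ (right_mem_Icc.2 zero_le_one) ht.2
  -- The chronological future of `γ t` is an open neighbourhood of the boundary point, so it meets
  -- `f(M)`; `γ t` then lies between two points of `f(M)`.
  obtain ⟨y, hy, hyf⟩ := mem_closure_iff.1 hpf.1 _ (isOpen_setOf_chron_right (γ t)) hchron
  exact hf.mem_range hN hS ⟨x, h0.symm⟩ hyf
    (hγ.chron (left_mem_Icc.2 zero_le_one) ⟨ht.1, ht.2.le⟩ ht0) hy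

/-- The generating curve is the lift `δ` to `M` of a timelike curve ending at `p`, with its endpoint
removed. -/
theorem IsConformalCauchyEmbedding.isTIP (hf : 𝒮.IsConformalCauchyEmbedding 𝒯 f)
    (hN : 𝒯.IsGloballyHyperbolic) {p : N} (hp : p ∈ 𝒮.futureBoundary 𝒯 f) :
    𝒮.IsTIP (f ⁻¹' (𝒯.chronPast {p} ∩ range f)) := by
  obtain ⟨S, hS, hpf, γ, hγ, rfl, hγf⟩ := hf.exists_curve_to_boundary hN hp
  obtain ⟨δ, hδ, hfδ⟩ := hf.exists_lift (IsCurve.restrict hγ Ico_subset_Icc_self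
    (nonempty_Ico.2 one_pos) ordConnected_Ico) hγf
  set P := f ⁻¹' (𝒯.chronPast {γ 1} ∩ range f) with hP
  have hmem : ∀ {x}, x ∈ P ↔ 𝒯.Chron (f x) (γ 1) := mem_preimage_chronPast_iff
  have hδP : ∀ t ∈ Ico (0 : ℝ) 1, δ t ∈ P := fun t ht => hmem.2 (by
    rw [hfδ t ht]
    exact hγ.chron ⟨ht.1, ht.2.le⟩ (right_mem_Icc.2 zero_le_one) ht.2)
  have hPδ : ∀ {x}, x ∈ P → ∃ t ∈ Ico (0 : ℝ) 1, 𝒮.Chron x (δ t) := by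
    intro x hx
    obtain ⟨t, ht, hxt⟩ := hγ.exists_chron_of_chron_end (hmem.1 hx)
    rw [← hfδ t ht] at hxt
    exact ⟨t, ht, hf.chron_of_map hN hS hxt⟩
  have hPpast : 𝒮.IsPastSet P := by
    constructor
    · have : P = f ⁻¹' {x | 𝒯.Chron x (γ 1)} := by ext x; exact hmem
      rw [this]
      exact (isOpen_setOf_chron_left _).preimage hf.continuous
    · intro y hy
      obtain ⟨x, hx, hyx⟩ := mem_chronPast_iff.1 hy
      exact hmem.2 ((hf.chron_map hyx).trans (hmem.1 hx))
  refine ⟨⟨⟨δ 0, hδP 0 (left_mem_Ico.2 one_pos)⟩, hPpast, ?_⟩, δ, Ico 0 1, hδ.isCausalCurve, ?_, ?_⟩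
  -- Points `x ∉ V` and `y ∉ W` of `P` both precede the later of two points of `δ`. That point lies
  -- in `V` or `W`, and the past set property yields a contradiction.
  · intro V W hV hW hVW
    by_contra! hcon
    obtain ⟨x, hxP, hxV⟩ := not_subset.1 fun h => hcon.1
      (subset_antisymm (hVW ▸ subset_union_left) h)
    obtain ⟨y, hyP, hyW⟩ := not_subset.1 fun h => hcon.2
      (subset_antisymm (hVW ▸ subset_union_right) h)
    obtain ⟨s, hs, hxs⟩ := hPδ hxP
    obtain ⟨t, ht, hyt⟩ := hPδ hyP
    have key : ∀ {z u}, u ∈ Ico (0 : ℝ) 1 → u ≤ max s t → 𝒮.Chron z (δ u) →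
        𝒮.Chron z (δ (max s t)) := by
      intro z u hu hle h
      rcases hle.eq_or_lt with rfl | hlt
      · exact h
      · exact h.trans (hδ.chron hu ⟨hu.1.trans hle, max_lt hs.2 ht.2⟩ hlt)
    have hmax := hδP (max s t) ⟨hs.1.trans (le_max_left _ _), max_lt hs.2 ht.2⟩
    rw [hVW] at hmax
    rcases hmax with h | h
    · exact hxV (hV.2 (mem_chronPast_iff.2 ⟨_, h, key hs (le_max_left _ _) hxs⟩))
    · exact hyW (hW.2 (mem_chronPast_iff.2 ⟨_, h, key ht (le_max_right _ _) hyt⟩))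
  -- An endpoint `q` of `δ` would give `f q = γ 1`, but the boundary point is outside the range.
  · rintro ⟨q, hq⟩
    have h1 : Tendsto (γ ∘ ((↑) : Ico (0 : ℝ) 1 → ℝ)) atTop (𝓝 (f q)) :=
      ((hf.continuous.tendsto q).comp hq).congr fun t => hfδ t t.2
    rw [← tendsto_map'_iff, map_coe_atTop_of_Ioo_subset (fun t ht => ht.2)
      (fun _ _ => ⟨0, one_pos, Ioo_subset_Ico_self⟩)] at h1
    have h2 : Tendsto γ (𝓝[<] 1) (𝓝 (γ 1)) :=
      ((IsCurve.continuousOn hγ 1 (right_mem_Icc.2 zero_le_one)).mono_of_mem_nhdsWithin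
        (Icc_mem_nhdsLT one_pos))
    exact hpf ⟨q, tendsto_nhds_unique h1 h2⟩
  · ext x
    rw [mem_chronPast_iff]
    constructor
    · intro hx
      obtain ⟨t, ht, hxt⟩ := hPδ hx
      exact ⟨_, mem_image_of_mem _ ht, hxt⟩
    · rintro ⟨_, ⟨t, ht, rfl⟩, hxt⟩
      exact hPpast.2 (mem_chronPast_iff.2 ⟨_, hδP t ht, hxt⟩)

/-- The inclusion places a timelike curve ending at `p` in the past of `q` before its end; its
endpoint then lies in the causal past of `q` by closedness of a diamond. -/
theorem IsConformalCauchyEmbedding.mem_causalFutureOf_of_subset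
    (hf : 𝒮.IsConformalCauchyEmbedding 𝒯 f) (hN : 𝒯.IsGloballyHyperbolic) {p q : N}
    (hp : p ∈ 𝒮.futureBoundary 𝒯 f)
    (hpq : f ⁻¹' (𝒯.chronPast {p} ∩ range f) ⊆ f ⁻¹' (𝒯.chronPast {q} ∩ range f)) :
    q ∈ 𝒯.causalFutureOf p := by
  obtain ⟨S, hS, hpf, γ, hγ, rfl, hγf⟩ := hf.exists_curve_to_boundary hN hp
  -- Starting from `γ 0` confines the points to one fixed diamond, which is compact and hence
  -- closed.
  have hmem : ∀ t ∈ Ioo (0 : ℝ) 1, γ t ∈ 𝒯.causalPastOf q ∩ 𝒯.causalFutureOf (γ 0) := by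
    intro t ht
    have ht' : t ∈ Icc (0 : ℝ) 1 := Ioo_subset_Icc_self ht
    obtain ⟨x, hx⟩ := hγf t ⟨ht.1.le, ht.2⟩
    have h1 : 𝒯.Chron (f x) q := mem_preimage_chronPast_iff.1 (hpq
      (mem_preimage_chronPast_iff.2 (hx ▸ hγ.chron ht' (right_mem_Icc.2 zero_le_one) ht.2)))
    rw [hx] at h1
    exact ⟨h1.mem_causalFutureOf,
      (hγ.chron (left_mem_Icc.2 zero_le_one) ht' ht.1).mem_causalFutureOf⟩
  have h2 : Tendsto γ (𝓝[<] 1) (𝓝 (γ 1)) :=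
    ((IsCurve.continuousOn hγ 1 (right_mem_Icc.2 zero_le_one)).mono_of_mem_nhdsWithin
      (Icc_mem_nhdsLT one_pos))
  exact ((hN.2 q (γ 0)).isClosed.mem_of_tendsto h2
    (Filter.mem_of_superset (Ioo_mem_nhdsLT one_pos) hmem)).1

end ConformalSpacetime

theorem proposition10 {n : ℕ}
    {M : Type*} [TopologicalSpace M] [T2Space M] [SecondCountableTopology M]
    [ChartedSpace (EuclideanSpace ℝ (Fin n)) M] [IsManifold (𝓡 n) ∞ M]
    {N : Type*} [TopologicalSpace N] [T2Space N] [SecondCountableTopology N]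
    [ChartedSpace (EuclideanSpace ℝ (Fin n)) N] [IsManifold (𝓡 n) ∞ N]
    (𝒮 : ConformalSpacetime n M) (𝒯 : ConformalSpacetime n N)
    (hM : 𝒮.IsGloballyHyperbolic) (hN : 𝒯.IsGloballyHyperbolic)
    (f : M → N) (hf : 𝒮.IsConformalCauchyEmbedding 𝒯 f) :
    (∀ p ∈ 𝒮.futureBoundary 𝒯 f, 𝒮.IsTIP (f ⁻¹' (𝒯.chronPast {p} ∩ range f))) ∧
    MapsTo (fun p => f ⁻¹' (𝒯.chronPast {p} ∩ range f))
      (𝒮.futureBoundary 𝒯 f) 𝒮.futureCausalBoundary ∧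
    InjOn (fun p => f ⁻¹' (𝒯.chronPast {p} ∩ range f)) (𝒮.futureBoundary 𝒯 f) := by
  refine ⟨fun p hp => hf.isTIP hN hp, fun p hp => hf.isTIP hN hp, fun p hp q hq hpq => ?_⟩
  -- Equal sets give both inclusions, hence `p ≤ q` and `q ≤ p`.
  exact hN.1.antisymm (hf.mem_causalFutureOf_of_subset hN hp hpq.subset)
    (hf.mem_causalFutureOf_of_subset hN hq hpq.superset)
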